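/- Fix a countably infinite set of names $a,b,x,\dots$. Terms are $s,t ::= a \mid s\bullet t$; patterns are $p,q ::= x \mid \ulcorner a\urcorner \mid p\bullet q$ (binding names, name-matches, compounds). A language $\mathcal L$ is one of the 48 choices of five features: asynchronous/synchronous, monadic/polyadic, dataspace-based/channel-based, no-matching/name-matching/intensional, binary/joining. Its processes are $$P,Q ::= \mathbf 0 \mid \surd \mid \mathit{Out} \mid \mathit{In} \mid (\nu a)P \mid P|Q \mid \mathbf{if}\ s=t\ \mathbf{then}\ P\ \mathbf{else}\ Q \mid {*P}.$$ An output carries a finite sequence of data (of length one if monadic), on a channel exactly if $\mathcal L$ is channel-based, and has a continuation, $s\langle\tilde t\rangle.P$, exactly if $\mathcal L$ is synchronous. An input process is $(s_1(\tilde p_1)|\dots|s_k(\tilde p_k))\triangleright Q$ with $k\ge1$ (and $k=1$ if binary), where the $\tilde p_i$ are finite sequences of patterns (of length one if monadic), the channels $s_i$ are present exactly if $\mathcal L$ is channel-based, and all binding names are distinct and bind in $Q$. Data and channels are terms and patterns are arbitrary in intensional languages; otherwise data and channels are names, and patterns are binding names (no-matching) or binding names and name-matches (name-matching). Structural equivalence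 $\equiv$ is the least equivalence relation that is closed under all operators except input, contains $\alpha$-equivalence, and satisfies $P|\mathbf 0\equiv P$, $P|Q\equiv Q|P$, $P|(Q|R)\equiv(P|Q)|R$, $(\mathbf{if}\ s=t\ \mathbf{then}\ P\ \mathbf{else}\ Q)\equiv P$ if $s=t$ and $\equiv Q$ if $s\ne t$, $(\nu a)\mathbf 0\equiv\mathbf 0$, $(\nu a)(\nu b)P\equiv(\nu b)(\nu a)P$, $P|(\nu a)Q\equiv(\nu a)(P|Q)$ if $a\notin\mathrm{fn}(P)$, and ${*P}\equiv P|{*P}$. Matching a term with a pattern is the partial operation $\{t/\!\!/x\}=\{t/x\}$, $\{a/\!\!/\ulcorner a\urcorner\}=\emptyset$, $\{s\bullet t/\!\!/p\bullet q\}=\{s/\!\!/p\}\cup\{t/\!\!/q\}$, undefined otherwise; sequences of equal length are matched componentwise. Reduction $\to$ is the least relation closed under parallel composition, restriction and $\equiv$ that contains $$s_1\langle\tilde t_1\rangle.P_1|\dots|s_k\langle\tilde t_k\rangle.P_k|(s_1(\tilde p_1)|\dots|s_k(\tilde p_k))\triangleright Q\;\to\;P_1|\dots|P_k|\sigma Q$$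 whenever $\sigma$ is the union of the matches of $\tilde t_i$ with $\tilde p_i$ (without the $P_i$ if asynchronous, without the $s_i$ if dataspace-based). Let $\Rightarrow$ be its reflexive transitive closure. $P$ diverges if it has an infinite sequence of reductions, and $P\Downarrow$ means $P\Rightarrow P'\equiv P''|\surd$ for some $P',P''$. The coordination degree $\mathrm{cd}(\mathcal L)\in\mathbb N\cup\{\infty\}$ is the least upper bound of the numbers $n$ of processes that must coordinate to yield a reduction, that is, for which there are processes $S_1,\dots,S_n$ of $\mathcal L$ such that $S_1|\dots|S_n$ can reduce, but cannot if any one $S_j$ is replaced by $\mathbf 0$. For each language let a reference behavioural equivalence $\asymp$ be given: any equivalence relation on its processes that is reduction-sensitive, i.e. if $P\asymp Q$ and $Q$ can reduce, then $P$ can reduce. An encoding of $\mathcal L_1$ into $\mathcal L_2$ is a map $[\![\cdot]\!]$ from $\mathcal L_1$-processes to $\mathcal L_2$-processes together with a map $\varphi$ from names to $k$-tuples of names, for some $k>0$. It is valid if (equality of processes being up to $\alpha$-equivalence): 1. (Compositionality) for every $k$-ary operator $\mathbf{op}$ of $\mathcal L_1$ and every set of names $N$ there is a $k$-ary context $C$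 of $\mathcal L_2$, in which each of the $k$ holes occurs exactly once, such that $[\![\mathbf{op}(S_1,\dots,S_k)]\!]=C([\![S_1]\!];\dots;[\![S_k]\!])$ for all $S_1,\dots,S_k$ with $\mathrm{fn}(S_1,\dots,S_k)=N$; 2. (Name invariance) for every $S$ and every finite-domain substitution $\sigma$ of names for names there is such a substitution $\sigma'$ with $\varphi(\sigma(a))=\sigma'(\varphi(a))$ for all $a$, and $[\![\sigma S]\!]=\sigma'[\![S]\!]$ if $\sigma$ is injective, $[\![\sigma S]\!]\asymp_2\sigma'[\![S]\!]$ otherwise; 3. (Operational correspondence) if $S\Rightarrow S'$ then $[\![S]\!]\Rightarrow\asymp_2[\![S']\!]$; and if $[\![S]\!]\Rightarrow T$ then there is $S'$ with $S\Rightarrow S'$ and $T\Rightarrow\asymp_2[\![S']\!]$; 4. (Divergence reflection) if $[\![S]\!]$ diverges then $S$ diverges; 5. (Success sensitiveness) $S\Downarrow$ if and only if $[\![S]\!]\Downarrow$. Theorem. If $\mathcal L_1$ and $\mathcal L_2$ are two of the 48 languages and $\mathrm{cd}(\mathcal L_1)>\mathrm{cd}(\mathcal L_2)$, then there is no valid encoding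 of $\mathcal L_1$ into $\mathcal L_2$. -/

import Mathlib

namespace Coordination

/-! ## Names, terms, patterns and the 48 languages -/

/-- The countably infinite set of names. -/
abbrev Name := ℕ

/-- Terms `s, t ::= a | s • t`. -/
inductive Term where
  | name (a : Name)
  | comp (s t : Term)

/-- Patterns `p, q ::= x | ⌜a⌝ | p • q`: binding names, name-matches, compounds. -/
inductive Pat where
  | bind (x : Name)
  | lit (a : Name)
  | comp (p q : Pat)

inductive Synchronism where
  | asynchronous
  | synchronous

inductive Arity where
  | monadic
  | polyadic

inductive Medium where
  | dataspace
  | channel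

inductive Matching where
  | noMatching
  | nameMatching
  | intensional

inductive Coord where
  | binary
  | joining

/-- A language is a choice of the five features, so there are 48 of them. -/
structure Lang where
  sync : Synchronism
  arity : Arity
  medium : Medium
  matching : Matching
  coord : Coord

namespace Term

def IsName : Term → Prop
  | name _ => True
  | comp _ _ => False

def names : Term → Finset Name
  | name a => {a}
  | comp s t => s.names ∪ t.names

def subst (σ : Name → Term) : Term → Term
  | name a => σ a
  | comp s t => comp (s.subst σ) (t.subst σ)

/-- Name-match syntax applied to a term: `⌜s • t⌝ = ⌜s⌝ • ⌜t⌝`. -/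
def quote : Term → Pat
  | name a => .lit a
  | comp s t => .comp s.quote t.quote

end Term

namespace Pat

/-- The binding names of a pattern, with repetitions. -/
def binders : Pat → List Name
  | bind x => [x]
  | lit _ => []
  | comp p q => p.binders ++ q.binders

def free : Pat → Finset Name
  | bind _ => ∅
  | lit a => {a}
  | comp p q => p.free ∪ q.free

def NoCompound : Pat → Prop
  | bind _ => True
  | lit _ => True
  | comp _ _ => False

def IsBind : Pat → Prop
  | bind _ => True
  | lit _ => False
  | comp _ _ => False

/-- Rename the binding names by `β` and substitute `σ` in the name-matches. -/
def act (β : Name → Name) (σ : Name → Term) : Pat → Pat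
  | bind x => bind (β x)
  | lit a => (σ a).quote
  | comp p q => comp (p.act β σ) (q.act β σ)

end Pat

/-- The data (and channels) of a language: arbitrary terms in the intensional languages, names in
the others. -/
structure Lang.Datum (L : Lang) where
  term : Term
  ok : L.matching = .intensional ∨ term.IsName

/-- The patterns of a language: only binding names, or no compounds, or all patterns. -/
def Lang.PatOk (L : Lang) (p : Pat) : Prop :=
  (L.matching = .noMatching → p.IsBind) ∧ (L.matching = .nameMatching → p.NoCompound)

structure Lang.Pattern (L : Lang) where
  pat : Pat
  ok : L.PatOk pat

variable {L : Lang}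

def Lang.Datum.ofName (a : Name) : L.Datum := ⟨.name a, Or.inr trivial⟩

theorem Term.subst_ok (σ : Name → L.Datum) (t : Term)
    (h : L.matching = .intensional ∨ t.IsName) :
    L.matching = .intensional ∨ (t.subst fun a => (σ a).1).IsName := by
  cases t with
  | name a => exact (σ a).2
  | comp s t => exact Or.inl (h.resolve_right id)

def Lang.Datum.subst (σ : Name → L.Datum) (d : L.Datum) : L.Datum :=
  ⟨d.1.subst fun a => (σ a).1, Term.subst_ok σ d.1 d.2⟩

theorem Pat.act_ok (β : Name → Name) (σ : Name → L.Datum) (p : Pat) (h : L.PatOk p) :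
    L.PatOk (p.act β fun a => (σ a).1) := by
  refine ⟨fun hm => ?_, fun hm => ?_⟩
  · have hp := h.1 hm
    cases p with
    | bind x => trivial
    | lit a => exact hp.elim
    | comp p q => exact hp.elim
  · have hp := h.2 hm
    cases p with
    | bind x => trivial
    | lit a =>
      have h1 := (σ a).2
      simp only [hm, reduceCtorEq, false_or] at h1
      simp only [Pat.act]
      cases hs : (σ a).1 with
      | name b => trivial
      | comp s t => rw [hs] at h1; exact h1.elim
    | comp p q => exact hp.elim

def Lang.Pattern.act (β : Name → Name) (σ : Name → L.Datum) (p : L.Pattern) : L.Pattern :=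
  ⟨p.1.act β fun a => (σ a).1, Pat.act_ok β σ p.1 p.2⟩

theorem Term.quote_binders (t : Term) : t.quote.binders = [] := by
  induction t with
  | name a => rfl
  | comp s t hs ht => simp [Term.quote, Pat.binders, hs, ht]

theorem Pat.act_binders (β : Name → Name) (σ : Name → Term) (p : Pat) :
    (p.act β σ).binders = p.binders.map β := by
  induction p with
  | bind x => rfl
  | lit a => simp [Pat.act, Pat.binders, Term.quote_binders]
  | comp p q hp hq => simp [Pat.act, Pat.binders, hp, hq]

/-! ## Outputs and inputs -/

/-- Outputs `OUT`: a channel exactly in the channel-based languages, and a sequence of data, of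
length one in the monadic languages. -/
structure Out (L : Lang) where
  chan : Option L.Datum
  args : List L.Datum
  chan_iff : chan.isSome ↔ L.medium = .channel
  arity : L.arity = .monadic → args.length = 1

/-- Single inputs `IN`. -/
structure Inp (L : Lang) where
  chan : Option L.Datum
  pats : List L.Pattern
  chan_iff : chan.isSome ↔ L.medium = .channel
  arity : L.arity = .monadic → pats.length = 1

namespace Out

def names (o : Out L) : Finset Name :=
  o.chan.elim ∅ (fun c => c.1.names) ∪ o.args.foldr (fun d s => d.1.names ∪ s) ∅

def subst (σ : Name → L.Datum) (o : Out L) : Out L where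
  chan := o.chan.map (Lang.Datum.subst σ)
  args := o.args.map (Lang.Datum.subst σ)
  chan_iff := by simpa using o.chan_iff
  arity := by simpa using o.arity

end Out

namespace Inp

def binders (i : Inp L) : List Name := i.pats.flatMap fun p => p.1.binders

def free (i : Inp L) : Finset Name :=
  i.chan.elim ∅ (fun c => c.1.names) ∪ i.pats.foldr (fun p s => p.1.free ∪ s) ∅

/-- Rename the binding names by `β` and substitute `σ` in the channel and the name-matches. -/
def act (β : Name → Name) (σ : Name → L.Datum) (i : Inp L) : Inp L where
  chan := i.chan.map (Lang.Datum.subst σ)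
  pats := i.pats.map (Lang.Pattern.act β σ)
  chan_iff := by simpa using i.chan_iff
  arity := by simpa using i.arity

theorem act_binders (β : Name → Name) (σ : Name → L.Datum) (i : Inp L) :
    (i.act β σ).binders = i.binders.map β := by
  simp only [binders, act, List.flatMap_map, List.map_flatMap]
  congr 1
  funext p
  exact Pat.act_binders β _ p.1

end Inp

/-- The part of an input process before its continuation: a nonempty sequence of inputs (a join),
of length one in the binary languages, in which all binding names are pairwise distinct. -/
structure Guard (L : Lang) where
  inputs : List (Inp L)
  ne_nil : inputs ≠ []
  binary : L.coord = .binary → inputs.length = 1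
  nodup : (inputs.flatMap Inp.binders).Nodup

namespace Guard

def binders (G : Guard L) : Finset Name := (G.inputs.flatMap Inp.binders).toFinset

def free (G : Guard L) : Finset Name := G.inputs.foldr (fun i s => i.free ∪ s) ∅

/-- Rename the binding names by `β` and substitute `σ` in the channels and the name-matches. -/
def act (β : Name ↪ Name) (σ : Name → L.Datum) (G : Guard L) : Guard L where
  inputs := G.inputs.map (Inp.act β σ)
  ne_nil := by simpa using G.ne_nil
  binary := by simpa using G.binary
  nodup := by
    have h : (G.inputs.map (Inp.act β σ)).flatMap Inp.binders
        = (G.inputs.flatMap Inp.binders).map β := by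
      simp only [List.flatMap_map, List.map_flatMap]
      congr 1
      funext i
      exact Inp.act_binders β σ i
    rw [h]
    exact G.nodup.map β.injective

end Guard

/-! ## Processes -/

/-- The processes of a language. Outputs have a continuation exactly in the synchronous languages;
the continuation of an input is in the scope of its binding names. -/
inductive Proc (L : Lang) where
  | nil
  | ok
  | outA (h : L.sync = .asynchronous) (o : Out L)
  | outS (h : L.sync = .synchronous) (o : Out L) (P : Proc L)
  | inp (G : Guard L) (P : Proc L)
  | res (a : Name) (P : Proc L)
  | par (P Q : Proc L)
  | ite (s t : Term) (P Q : Proc L)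
  | rep (P : Proc L)

/-- A number larger than all names in the terms `σ c` for `c ∈ s`. -/
def freshShift (s : Finset Name) (σ : Name → L.Datum) : ℕ :=
  (s.biUnion fun c => (σ c).1.names).sup id + 1

namespace Proc

/-- Free names. -/
def fn : Proc L → Finset Name
  | nil => ∅
  | ok => ∅
  | outA _ o => o.names
  | outS _ o P => o.names ∪ P.fn
  | inp G P => G.free ∪ (P.fn \ G.binders)
  | res a P => P.fn \ {a}
  | par P Q => P.fn ∪ Q.fn
  | ite s t P Q => s.names ∪ t.names ∪ P.fn ∪ Q.fn
  | rep P => P.fn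

/-- Apply a permutation of names to all names of a process, bound ones included. -/
def rename (π : Equiv.Perm Name) : Proc L → Proc L
  | nil => nil
  | ok => ok
  | outA h o => outA h (o.subst fun a => .ofName (π a))
  | outS h o P => outS h (o.subst fun a => .ofName (π a)) (P.rename π)
  | inp G P => inp (G.act π.toEmbedding fun a => .ofName (π a)) (P.rename π)
  | res a P => res (π a) (P.rename π)
  | par P Q => par (P.rename π) (Q.rename π)
  | ite s t P Q =>
      ite (s.subst fun a => .name (π a)) (t.subst fun a => .name (π a)) (P.rename π) (Q.rename π)
  | rep P => rep (P.rename π)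

/-- Capture-avoiding simultaneous substitution. At each binder, the bound names are first renamed by
adding a number that exceeds every name that `σ` brings into the scope of the binder. -/
def subst : (Name → L.Datum) → Proc L → Proc L
  | _, nil => nil
  | _, ok => ok
  | σ, outA h o => outA h (o.subst σ)
  | σ, outS h o P => outS h (o.subst σ) (P.subst σ)
  | σ, inp G P =>
      let m := freshShift (P.fn \ G.binders) σ
      inp (G.act (addRightEmbedding m) σ)
        (P.subst fun x => if x ∈ G.binders then .ofName (x + m) else σ x)
  | σ, res a P =>
      let m := freshShift (P.fn \ {a}) σ
      res (a + m) (P.subst fun x => if x = a then .ofName (x + m) else σ x)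
  | σ, par P Q => par (P.subst σ) (Q.subst σ)
  | σ, ite s t P Q =>
      ite (s.subst fun a => (σ a).1) (t.subst fun a => (σ a).1) (P.subst σ) (Q.subst σ)
  | σ, rep P => rep (P.subst σ)

/-- Application of a substitution of names for names. -/
def substName (σ : Name → Name) (P : Proc L) : Proc L := P.subst fun a => .ofName (σ a)

/-- The parallel composition of a list of processes. -/
def parAll (Ps : List (Proc L)) : Proc L := Ps.foldr par nil

end Proc

open Proc

/-- Alpha-equivalence: the least congruence that allows a permutation of names to be applied to a
binder and its scope when it fixes the other free names of the scope. -/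
inductive AlphaEq : Proc L → Proc L → Prop
  | refl (P) : AlphaEq P P
  | symm {P Q} : AlphaEq P Q → AlphaEq Q P
  | trans {P Q R} : AlphaEq P Q → AlphaEq Q R → AlphaEq P R
  | outS {P Q} (h o) : AlphaEq P Q → AlphaEq (outS h o P) (outS h o Q)
  | inp {P Q} (G) : AlphaEq P Q → AlphaEq (inp G P) (inp G Q)
  | res {P Q} (a) : AlphaEq P Q → AlphaEq (res a P) (res a Q)
  | par {P P' Q Q'} : AlphaEq P P' → AlphaEq Q Q' → AlphaEq (par P Q) (par P' Q')
  | ite {P P' Q Q'} (s t) : AlphaEq P P' → AlphaEq Q Q' → AlphaEq (ite s t P Q) (ite s t P' Q')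
  | rep {P Q} : AlphaEq P Q → AlphaEq (rep P) (rep Q)
  | res_rename (a P) (π : Equiv.Perm Name) (h : ∀ c ∈ P.fn \ {a}, π c = c) :
      AlphaEq (res a P) (res (π a) (P.rename π))
  | inp_rename (G P) (π : Equiv.Perm Name) (h : ∀ c ∈ P.fn \ G.binders, π c = c) :
      AlphaEq (inp G P) (inp (G.act π.toEmbedding .ofName) (P.rename π))

/-- Structural equivalence. It is closed under all operators except input: under an input, names may
still be instantiated, so that a conditional there must not be resolved yet. -/
inductive StructEq : Proc L → Proc L → Prop
  | refl (P) : StructEq P P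
  | symm {P Q} : StructEq P Q → StructEq Q P
  | trans {P Q R} : StructEq P Q → StructEq Q R → StructEq P R
  | outS {P Q} (h o) : StructEq P Q → StructEq (outS h o P) (outS h o Q)
  | res {P Q} (a) : StructEq P Q → StructEq (res a P) (res a Q)
  | par {P P' Q Q'} : StructEq P P' → StructEq Q Q' → StructEq (par P Q) (par P' Q')
  | ite {P P' Q Q'} (s t) : StructEq P P' → StructEq Q Q' →
      StructEq (ite s t P Q) (ite s t P' Q')
  | rep {P Q} : StructEq P Q → StructEq (rep P) (rep Q)
  | par_nil (P) : StructEq (par P nil) P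
  | par_comm (P Q) : StructEq (par P Q) (par Q P)
  | par_assoc (P Q R) : StructEq (par P (par Q R)) (par (par P Q) R)
  | ite_pos (s t P Q) : s = t → StructEq (ite s t P Q) P
  | ite_neg (s t P Q) : s ≠ t → StructEq (ite s t P Q) Q
  | alpha {P Q} : AlphaEq P Q → StructEq P Q
  | res_nil (a) : StructEq (res a nil) nil
  | res_comm (a b P) : StructEq (res a (res b P)) (res b (res a P))
  | res_par (a P Q) : a ∉ P.fn → StructEq (par P (res a Q)) (res a (par P Q))
  | rep_unfold (P) : StructEq (rep P) (par P (rep P))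

/-! ## Matching and reduction -/

/-- The match rule; a substitution with finite domain is given by the list of its assignments. -/
def matchPat : (t : Term) → (L.matching = .intensional ∨ t.IsName) → Pat →
    Option (List (Name × L.Datum))
  | t, h, .bind x => some [(x, ⟨t, h⟩)]
  | .name a, _, .lit b => if a = b then some [] else none
  | .comp s t, h, .comp p q =>
      match matchPat s (Or.inl (h.resolve_right id)) p,
        matchPat t (Or.inl (h.resolve_right id)) q with
      | some σ₁, some σ₂ => some (σ₁ ++ σ₂)
      | _, _ => none
  | _, _, _ => none

/-- The poly-match rule. -/
def polyMatch : List L.Datum → List L.Pattern → Option (List (Name × L.Datum))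
  | [], [] => some []
  | t :: ts, p :: ps =>
      match matchPat t.1 t.2 p.1, polyMatch ts ps with
      | some σ₁, some σ₂ => some (σ₁ ++ σ₂)
      | _, _ => none
  | _, _ => none

open Classical in
/-- The union of the poly-matches of a sequence of outputs with a sequence of inputs of the same
length, where the channels (if any) have to agree. -/
noncomputable def joinMatch : List (Out L) → List (Inp L) → Option (List (Name × L.Datum))
  | [], [] => some []
  | o :: os, i :: is =>
      if o.chan = i.chan then
        match polyMatch o.args i.pats, joinMatch os is with
        | some σ₁, some σ₂ => some (σ₁ ++ σ₂)
        | _, _ => none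
      else none
  | _, _ => none

/-- The substitution given by a list of assignments; it is the identity outside its domain. -/
def toSubst (l : List (Name × L.Datum)) (x : Name) : L.Datum := (l.lookup x).getD (.ofName x)

/-- Reduction. In the binary languages a guard has one input, and the interaction axioms are then
those of one output and one input. -/
inductive Red : Proc L → Proc L → Prop
  | commA (h : L.sync = .asynchronous) (os : List (Out L)) (G : Guard L) (Q : Proc L)
      (σ : List (Name × L.Datum)) (hσ : joinMatch os G.inputs = some σ) :
      Red (par (parAll (os.map (outA h))) (inp G Q)) (Q.subst (toSubst σ))
  | commS (h : L.sync = .synchronous) (es : List (Out L × Proc L)) (G : Guard L) (Q : Proc L)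
      (σ : List (Name × L.Datum)) (hσ : joinMatch (es.map Prod.fst) G.inputs = some σ) :
      Red (par (parAll (es.map fun e => outS h e.1 e.2)) (inp G Q))
        (par (parAll (es.map Prod.snd)) (Q.subst (toSubst σ)))
  | par {P P'} (Q) : Red P P' → Red (par P Q) (par P' Q)
  | res {P P'} (a) : Red P P' → Red (res a P) (res a P')
  | struct {P Q Q' P'} : StructEq P Q → Red Q Q' → StructEq Q' P' → Red P P'

namespace Proc

/-- The process can perform a reduction. -/
def Reduces (P : Proc L) : Prop := ∃ P', Red P P'

/-- The reflexive transitive closure of reduction. -/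
def Reds : Proc L → Proc L → Prop := Relation.ReflTransGen Red

/-- There is an infinite sequence of reductions from the process. -/
def Diverges (P : Proc L) : Prop := ∃ f : ℕ → Proc L, f 0 = P ∧ ∀ n, Red (f n) (f (n + 1))

/-- The process can reach a state with success at top level. -/
def Succeeds (P : Proc L) : Prop := ∃ P' P'', Reds P P' ∧ StructEq P' (par P'' ok)

end Proc

/-! ## Coordination degree -/

/-- Some `n` processes of the language have to coordinate to yield a reduction: together they reduce,
but not if any one of them is replaced by the null process. -/
def Lang.MustCoordinate (L : Lang) (n : ℕ) : Prop :=
  ∃ S : Fin n → Proc L, (parAll (List.ofFn S)).Reduces ∧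
    ∀ j, ¬ (parAll (List.ofFn (Function.update S j nil))).Reduces

/-- The coordination degree: the least upper bound, possibly infinite, of the numbers of processes
that must coordinate to yield a reduction. -/
noncomputable def Lang.cood (L : Lang) : ℕ∞ := ⨆ (n : ℕ) (_ : L.MustCoordinate n), (n : ℕ∞)

/-! ## Encodings -/

/-- The operators of a language. -/
inductive Op (L : Lang) where
  | nil
  | ok
  | outA (h : L.sync = .asynchronous) (o : Out L)
  | outS (h : L.sync = .synchronous) (o : Out L)
  | inp (G : Guard L)
  | res (a : Name)
  | par
  | ite (s t : Term)
  | rep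

namespace Op

def arity : Op L → ℕ
  | nil => 0
  | ok => 0
  | outA _ _ => 0
  | outS _ _ => 1
  | inp _ => 1
  | res _ => 1
  | par => 2
  | ite _ _ => 2
  | rep => 1

def apply : (o : Op L) → (Fin o.arity → Proc L) → Proc L
  | nil, _ => .nil
  | ok, _ => .ok
  | outA h o, _ => .outA h o
  | outS h o, S => .outS h o (S (0 : Fin 1))
  | inp G, S => .inp G (S (0 : Fin 1))
  | res a, S => .res a (S (0 : Fin 1))
  | par, S => .par (S (0 : Fin 2)) (S (1 : Fin 2))
  | ite s t, S => .ite s t (S (0 : Fin 2)) (S (1 : Fin 2))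
  | rep, S => .rep (S (0 : Fin 1))

end Op

/-- Process terms with holes numbered by `Fin k`. -/
inductive Ctx (L : Lang) (k : ℕ) where
  | hole (i : Fin k)
  | op (o : Op L) (args : Fin o.arity → Ctx L k)

namespace Ctx

variable {k : ℕ}

/-- Fill the holes; the binders of the context may capture names. -/
def fill (S : Fin k → Proc L) : Ctx L k → Proc L
  | hole i => S i
  | op o args => o.apply fun j => (args j).fill S

/-- The number of occurrences of a hole. -/
def count (i : Fin k) : Ctx L k → ℕ
  | hole j => if j = i then 1 else 0
  | op _ args => ∑ j, (args j).count i

/-- Every hole occurs exactly once, so that this is a `k`-ary context. -/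
def Linear (C : Ctx L k) : Prop := ∀ i, C.count i = 1

end Ctx

/-- An encoding: a translation of processes together with a renaming policy, which maps every name to
a tuple of `k > 0` names. -/
structure Encoding (L₁ L₂ : Lang) where
  enc : Proc L₁ → Proc L₂
  k : ℕ
  k_pos : 0 < k
  policy : Name → Fin k → Name

/-- A substitution of names for names with finite domain. -/
def IsNameSubst (σ : Name → Name) : Prop := {a | σ a ≠ a}.Finite

/-- Valid encodings, with respect to the reference behavioural equivalence `eqv` of the target.
Processes are compared up to alpha-equivalence where the criteria ask for equality. -/
structure Encoding.Valid {L₁ L₂ : Lang} (eqv : Proc L₂ → Proc L₂ → Prop) (E : Encoding L₁ L₂) :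
    Prop where
  compositional : ∀ (o : Op L₁) (N : Finset Name), ∃ C : Ctx L₂ o.arity, C.Linear ∧
    ∀ S : Fin o.arity → Proc L₁, (Finset.univ.biUnion fun i => (S i).fn) = N →
      AlphaEq (E.enc (o.apply S)) (C.fill fun i => E.enc (S i))
  name_invariant : ∀ (S : Proc L₁) (σ : Name → Name), IsNameSubst σ →
    ∃ σ' : Name → Name, IsNameSubst σ' ∧ (∀ a i, E.policy (σ a) i = σ' (E.policy a i)) ∧
      (Function.Injective σ → AlphaEq (E.enc (S.substName σ)) ((E.enc S).substName σ')) ∧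
      (¬ Function.Injective σ → eqv (E.enc (S.substName σ)) ((E.enc S).substName σ'))
  complete : ∀ S S', Reds S S' → ∃ T, Reds (E.enc S) T ∧ eqv T (E.enc S')
  sound : ∀ S T, Reds (E.enc S) T → ∃ S' T', Reds S S' ∧ Reds T T' ∧ eqv T' (E.enc S')
  divergence_reflecting : ∀ S, (E.enc S).Diverges → S.Diverges
  success_sensitive : ∀ S, S.Succeeds ↔ (E.enc S).Succeeds

/-- Equivalent processes agree on whether they can reduce. -/
def ReductionSensitive (eqv : Proc L → Proc L → Prop) : Prop :=
  ∀ P Q, eqv P Q → Q.Reduces → P.Reduces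

end Coordination

namespace Coordination

variable {L : Lang}

/-! The coordination degree is 2 for binary languages (`Lang.cood_eq_two`) and infinite for joining
ones (`Lang.cood_eq_top`), so the hypothesis forces `L₁` to be joining and `L₂` binary.

In `L₁`, take a receiver that joins two inputs, together with two senders. The three components
succeed together, but with any one of them replaced by an inert process there is neither success nor
a reduction (`not_reduces_update_team`). Suppose a valid encoding exists. The translated team
succeeds, so it has success at top level or can reduce.

In a binary language a reduction is the meeting of one exposed output with one exposed input.
`reduces_iff_communicates` turns this into the predicate `Communicates`, defined by recursion on the
syntax. Contexts are local (`IsLocal.fill`): a top-level success stems from one filled component and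
a communication from at most two. By compositionality the translation of the team is a context
filled with the three translated components (`exists_isLocal`), so one component is not involved.

Replace that component by an inert process with the same free names, so that the context stays the
same. The new translation still has top-level success or still reduces. The former contradicts
success sensitiveness. The latter contradicts `reduces_of_reduces_enc`: the translation of a process
that cannot reduce would, by soundness and reduction sensitivity, reduce forever, against divergence
reflection. -/

theorem Term.subst_injective {f : Name → Name} (hf : Function.Injective f) :
    Function.Injective (Term.subst fun a => .name (f a)) := by
  intro s
  induction s with
  | name a =>
    intro t h
    cases t with
    | name b => simpa [Term.subst, hf.eq_iff] using h
    | comp t u => simp [Term.subst] at h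
  | comp s s' ih ih' =>
    intro t h
    cases t with
    | name b => simp [Term.subst] at h
    | comp t u =>
      simp only [Term.subst, Term.comp.injEq] at h
      rw [ih h.1, ih' h.2]

theorem Term.subst_perm_inj (π : Equiv.Perm Name) (s t : Term) :
    (s.subst fun a => .name (π a)) = (t.subst fun a => .name (π a)) ↔ s = t :=
  (Term.subst_injective π.injective).eq_iff

namespace Proc

/-! ## Counting the prefixes at top level -/

open Classical in
/-- The number of outputs at top level. -/
noncomputable def outCount : Proc L → ℕ∞
  | nil => 0
  | ok => 0
  | outA _ _ => 1
  | outS _ _ _ => 1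
  | inp _ _ => 0
  | res _ P => P.outCount
  | par P Q => P.outCount + Q.outCount
  | ite s t P Q => if s = t then P.outCount else Q.outCount
  -- Since `⊤ * 0 = 0`, this value absorbs a further copy of `P`, as `rep_unfold` requires.
  | rep P => ⊤ * P.outCount

open Classical in
/-- The least number of outputs that an input at top level asks for. -/
noncomputable def demand : Proc L → ℕ∞
  -- `⊤` is the infimum over no inputs.
  | nil => ⊤
  | ok => ⊤
  | outA _ _ => ⊤
  | outS _ _ _ => ⊤
  | inp G _ => G.inputs.length
  | res _ P => P.demand
  | par P Q => P.demand ⊓ Q.demand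
  | ite s t P Q => if s = t then P.demand else Q.demand
  | rep P => P.demand

/-- Success occurs at top level. -/
def HasOk : Proc L → Prop
  | nil => False
  | ok => True
  | outA _ _ => False
  | outS _ _ _ => False
  | inp _ _ => False
  | res _ P => P.HasOk
  | par P Q => P.HasOk ∨ Q.HasOk
  | ite s t P Q => (s = t ∧ P.HasOk) ∨ (s ≠ t ∧ Q.HasOk)
  | rep P => P.HasOk

theorem outCount_rename (π : Equiv.Perm Name) (P : Proc L) :
    (P.rename π).outCount = P.outCount := by
  induction P with
  | ite s t P Q ihP ihQ =>
    simp only [rename, outCount, ihP, ihQ]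
    classical exact if_congr (Term.subst_perm_inj π s t) rfl rfl
  | _ => simp_all [rename, outCount]

theorem demand_rename (π : Equiv.Perm Name) (P : Proc L) :
    (P.rename π).demand = P.demand := by
  induction P with
  | ite s t P Q ihP ihQ =>
    simp only [rename, demand, ihP, ihQ]
    classical exact if_congr (Term.subst_perm_inj π s t) rfl rfl
  | _ => simp_all [rename, demand, Guard.act]

theorem hasOk_rename (π : Equiv.Perm Name) (P : Proc L) :
    (P.rename π).HasOk ↔ P.HasOk := by
  induction P <;> simp_all [rename, HasOk, Term.subst_perm_inj]

end Proc

open Proc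

/-! ### Invariance of the counts, and a necessary condition for reduction -/

theorem AlphaEq.counts_eq {P Q : Proc L} (h : AlphaEq P Q) :
    P.outCount = Q.outCount ∧ P.demand = Q.demand ∧ (P.HasOk ↔ Q.HasOk) := by
  induction h with
  | res_rename a P π h =>
    simp [outCount, demand, HasOk, outCount_rename, demand_rename, hasOk_rename]
  | inp_rename G P π h => simp [outCount, demand, HasOk, Guard.act]
  | _ => simp_all [outCount, demand, HasOk]

theorem StructEq.counts_eq {P Q : Proc L} (h : StructEq P Q) :
    P.outCount = Q.outCount ∧ P.demand = Q.demand ∧ (P.HasOk ↔ Q.HasOk) := by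
  induction h with
  | alpha h => exact h.counts_eq
  | par_comm P Q => simp [outCount, demand, HasOk, add_comm, inf_comm, or_comm]
  | par_assoc P Q R => simp [outCount, demand, HasOk, add_assoc, inf_assoc, or_assoc]
  | rep_unfold P =>
    refine ⟨?_, by simp [demand], by simp [HasOk]⟩
    rcases eq_or_ne P.outCount 0 with h | h
    · simp [outCount, h]
    · simp [outCount, ENat.top_mul h]
  | _ => simp_all [outCount, demand, HasOk]

namespace Proc

theorem outCount_parAll (Ps : List (Proc L)) :
    (parAll Ps).outCount = (Ps.map outCount).sum := by
  induction Ps with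
  | nil => rfl
  | cons P Ps ih => simpa [parAll, outCount] using congrArg (P.outCount + ·) ih

theorem hasOk_parAll (Ps : List (Proc L)) : (parAll Ps).HasOk ↔ ∃ P ∈ Ps, P.HasOk := by
  induction Ps with
  | nil => simp [parAll, HasOk]
  | cons P Ps ih =>
    have : (parAll (P :: Ps)).HasOk ↔ P.HasOk ∨ (parAll Ps).HasOk := Iff.rfl
    simp [this, ih]

theorem le_demand_parAll {n : ℕ∞} (Ps : List (Proc L)) :
    n ≤ (parAll Ps).demand ↔ ∀ P ∈ Ps, n ≤ P.demand := by
  induction Ps with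
  | nil => simp [parAll, demand]
  | cons P Ps ih =>
    have : (parAll (P :: Ps)).demand = P.demand ⊓ (parAll Ps).demand := rfl
    simp [this, ih]

end Proc

theorem joinMatch_length {os : List (Out L)} {is : List (Inp L)} {σ} 
    (h : joinMatch os is = some σ) : os.length = is.length := by
  induction os generalizing is σ with
  | nil => cases is <;> simp_all [joinMatch]
  | cons o os ih =>
    cases is with
    | nil => simp [joinMatch] at h
    | cons i is =>
      simp only [joinMatch] at h
      split_ifs at h
      split at h
      · rename_i h2
        simp [ih h2]
      · simp at h

/-- A join consumes one output per input, so some top-level input must find as many outputs as it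
asks for. This necessary condition holds in joining languages too and is what blocks the incomplete
teams. -/
theorem Red.demand_le {P Q : Proc L} (h : Red P Q) : P.demand ≤ P.outCount := by
  induction h with
  | commA h os G Q σ hσ =>
    refine (inf_le_right).trans (le_trans ?_ le_self_add)
    simp [outCount_parAll, demand, ← joinMatch_length hσ, Function.comp_def, outCount]
  | commS h es G Q σ hσ =>
    refine (inf_le_right).trans (le_trans ?_ le_self_add)
    simp [outCount_parAll, demand, ← joinMatch_length hσ, Function.comp_def, outCount]
  | par Q _ ih => exact (inf_le_left.trans ih).trans le_self_add
  | res a _ ih => exact ih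
  | struct h _ _ ih => rw [h.counts_eq.1, h.counts_eq.2.1]; exact ih

/-- A process with top-level success is structurally a parallel composition with success. -/
theorem Proc.HasOk.exists_structEq {P : Proc L} (h : P.HasOk) :
    ∃ P', StructEq P (par P' ok) := by
  induction P with
  | ok => exact ⟨nil, (StructEq.par_nil _).symm.trans (.par_comm _ _)⟩
  | res a P ih =>
    obtain ⟨P', h'⟩ := ih h
    exact ⟨res a P', ((h'.trans (.par_comm _ _)).res a).trans
      ((StructEq.res_par a ok P' (by simp [fn])).symm.trans (.par_comm _ _))⟩
  | par P Q ihP ihQ =>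
    rcases h with h | h
    · obtain ⟨P', h'⟩ := ihP h
      exact ⟨par Q P', (StructEq.par_comm _ _).trans
        ((StructEq.par (.refl _) h').trans (.par_assoc _ _ _))⟩
    · obtain ⟨Q', h'⟩ := ihQ h
      exact ⟨par P Q', (StructEq.par (.refl _) h').trans (.par_assoc _ _ _)⟩
  | ite s t P Q ihP ihQ =>
    rcases h with ⟨e, h⟩ | ⟨e, h⟩
    · obtain ⟨P', h'⟩ := ihP h
      exact ⟨P', (StructEq.ite_pos _ _ _ _ e).trans h'⟩
    · obtain ⟨Q', h'⟩ := ihQ h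
      exact ⟨Q', (StructEq.ite_neg _ _ _ _ e).trans h'⟩
  | rep P ih =>
    obtain ⟨P', h'⟩ := ih h
    exact ⟨par (rep P) P', (StructEq.rep_unfold P).trans ((StructEq.par_comm _ _).trans
      ((StructEq.par (.refl _) h').trans (.par_assoc _ _ _)))⟩
  | _ => exact h.elim

theorem Proc.HasOk.succeeds {P : Proc L} (h : P.HasOk) : P.Succeeds :=
  let ⟨P', h'⟩ := h.exists_structEq
  ⟨P, P', .refl, h'⟩

/-- Success after no step is visible at top level; otherwise there is a first step. Both
alternatives are properties to which locality applies. -/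
theorem Proc.Succeeds.hasOk_or_reduces {P : Proc L} (h : P.Succeeds) : P.HasOk ∨ P.Reduces := by
  obtain ⟨P', P'', h, h'⟩ := h
  rcases Relation.ReflTransGen.cases_head h with rfl | ⟨Q, hQ, -⟩
  · exact Or.inl (h'.counts_eq.2.2.2 (Or.inr trivial))
  · exact Or.inr ⟨Q, hQ⟩

/-! ## Shapes: patterns without their binding names, in which some names are hidden -/

/-- Terms and patterns seen from outside: the binding names are forgotten, and `none` stands for a
name that is restricted. -/
inductive Shape where
  | bind
  | atom (a : Option Name)
  | comp (p q : Shape)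

namespace Shape

def map (f : Name → Option Name) : Shape → Shape
  | bind => bind
  | atom a => atom (a.bind f)
  | comp p q => comp (p.map f) (q.map f)

def Mem (a : Name) : Shape → Prop
  | bind => False
  | atom b => b = some a
  | comp p q => p.Mem a ∨ q.Mem a

/-- A term shape matches a pattern shape; a restricted name matches binding names only. -/
def Matches : Shape → Shape → Prop
  | _, bind => True
  | atom (some a), atom (some b) => a = b
  | comp s t, comp p q => s.Matches p ∧ t.Matches q
  | _, _ => False

theorem map_map (f g : Name → Option Name) (p : Shape) :
    (p.map g).map f = p.map fun a => (g a).bind f := by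
  induction p with
  | atom a => simp [map, Option.bind_assoc]
  | _ => simp_all [map]

theorem map_congr {f g : Name → Option Name} {p : Shape} (h : ∀ a, p.Mem a → f a = g a) :
    p.map f = p.map g := by
  induction p with
  | bind => rfl
  | atom a => cases a <;> simp_all [map, Mem]
  | comp p q hp hq =>
    rw [map, map, hp fun a ha => h a (Or.inl ha), hq fun a ha => h a (Or.inr ha)]

theorem map_some : map some = id := by
  funext p
  induction p with
  | atom a => simp [map]
  | _ => simp_all [map]

theorem mem_map {f : Name → Option Name} {p : Shape} {b : Name} :
    (p.map f).Mem b ↔ ∃ a, p.Mem a ∧ f a = some b := by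
  induction p with
  | bind => simp [map, Mem]
  | atom a => simp [map, Mem, Option.bind_eq_some_iff]
  | comp p q hp hq => simp [map, Mem, hp, hq, or_and_right, exists_or]

/-- Partial identities only hide names, and a hidden name can match nothing but a binding name, so
hiding never creates a match. -/
theorem Matches.of_map {f g : Name → Option Name} (hf : ∀ a b, f a = some b → b = a)
    (hg : ∀ a b, g a = some b → b = a) {t p : Shape} (h : (t.map f).Matches (p.map g)) :
    t.Matches p := by
  induction p generalizing t with
  | bind => simp [Matches]
  | atom b =>
    rcases t with _ | (_ | a) | _ <;> rcases b with _ | b <;> simp [map, Matches] at h ⊢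
    cases hfa : f a <;> cases hgb : g b <;> simp [hfa, hgb, Matches] at h
    rw [← hf _ _ hfa, ← hg _ _ hgb, h]
  | comp p q hp hq =>
    cases t <;> simp only [map, Matches] at h ⊢
    exact ⟨hp h.1, hq h.2⟩

/-- A match compares only names that occur on both sides; whatever meets a binding name may be
hidden or renamed at will. -/
theorem Matches.map {f g : Name → Option Name} {t p : Shape} (h : t.Matches p)
    (hfg : ∀ a, t.Mem a → p.Mem a → f a = g a ∧ f a ≠ none) : (t.map f).Matches (p.map g) := by
  induction p generalizing t with
  | bind => simp [Shape.map, Matches]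
  | atom b =>
    rcases t with _ | (_ | a) | _ <;> rcases b with _ | b <;> simp [Matches] at h
    subst h
    obtain ⟨h1, h2⟩ := hfg a rfl rfl
    obtain ⟨c, hc⟩ := Option.ne_none_iff_exists'.1 h2
    simp [Shape.map, ← h1, hc, Matches]
  | comp p q hp hq =>
    cases t <;> simp only [Shape.map, Matches] at h ⊢
    exact ⟨hp h.1 fun a h1 h2 => hfg a (Or.inl h1) (Or.inl h2),
      hq h.2 fun a h1 h2 => hfg a (Or.inr h1) (Or.inr h2)⟩

end Shape

def Pat.shape : Pat → Shape
  | bind _ => .bind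
  | lit a => .atom (some a)
  | comp p q => .comp p.shape q.shape

def Term.shape (t : Term) : Shape := t.quote.shape

theorem Term.mem_shape {t : Term} {a : Name} : t.shape.Mem a ↔ a ∈ t.names := by
  induction t with
  | name b => simp [shape, quote, Pat.shape, Shape.Mem, names, eq_comm]
  | comp s t hs ht => simp_all [shape, quote, Pat.shape, Shape.Mem, names]

theorem Pat.mem_shape {p : Pat} {a : Name} : p.shape.Mem a ↔ a ∈ p.free := by
  induction p with
  | lit b => simp [Pat.shape, Shape.Mem, free, eq_comm]
  | _ => simp_all [Pat.shape, Shape.Mem, free]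

theorem Term.shape_subst (f : Name → Name) (t : Term) :
    (t.subst fun a => .name (f a)).shape = t.shape.map fun a => some (f a) := by
  induction t with
  | name b => simp [shape, quote, Pat.shape, Shape.map, subst]
  | comp s t hs ht => simp_all [shape, quote, Pat.shape, Shape.map, subst]

theorem Pat.shape_act (β f : Name → Name) (p : Pat) :
    (p.act β fun a => .name (f a)).shape = p.shape.map fun a => some (f a) := by
  induction p with
  | lit b => simp [Pat.shape, Shape.map, act, Term.quote]
  | _ => simp_all [Pat.shape, Shape.map, act]

/-- The shape of a term contains no `bind`. This lets a channel be treated as one more pattern. -/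
theorem Term.shape_matches_shape {s t : Term} : s.shape.Matches t.shape ↔ s = t := by
  induction t generalizing s with
  | name b => cases s <;> simp [shape, quote, Pat.shape, Shape.Matches]
  | comp t t' ih ih' =>
    cases s with
    | name a => simp [shape, quote, Pat.shape, Shape.Matches]
    | comp s s' =>
      have : (Term.comp s s').shape.Matches (Term.comp t t').shape ↔
        s.shape.Matches t.shape ∧ s'.shape.Matches t'.shape := Iff.rfl
      simp [this, ih, ih']

theorem isSome_matchPat {t : Term} (h : L.matching = .intensional ∨ t.IsName) {p : Pat} :
    (matchPat t h p).isSome ↔ t.shape.Matches p.shape := by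
  induction p generalizing t with
  | bind x => cases t <;> simp [matchPat, Pat.shape, Shape.Matches]
  | lit b =>
    cases t with
    | name a => by_cases e : a = b <;>
        simp [matchPat, Pat.shape, Shape.Matches, Term.shape, Term.quote, e]
    | comp s t => simp [matchPat, Pat.shape, Shape.Matches, Term.shape, Term.quote]
  | comp p q hp hq =>
    cases t with
    | name a => simp [matchPat, Pat.shape, Shape.Matches, Term.shape, Term.quote]
    | comp s t =>
      have : (Term.comp s t).shape.Matches (Pat.comp p q).shape ↔
        s.shape.Matches p.shape ∧ t.shape.Matches q.shape := Iff.rfl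
      rw [this, ← hp (Or.inl (h.resolve_right id)), ← hq (Or.inl (h.resolve_right id)), matchPat]
      cases matchPat s (Or.inl (h.resolve_right id)) p <;>
        cases matchPat t (Or.inl (h.resolve_right id)) q <;> simp

theorem isSome_polyMatch {ts : List L.Datum} {ps : List L.Pattern} :
    (polyMatch ts ps).isSome ↔
      List.Forall₂ Shape.Matches (ts.map fun t => t.1.shape) (ps.map fun p => p.1.shape) := by
  induction ts generalizing ps with
  | nil => cases ps <;> simp [polyMatch]
  | cons t ts ih =>
    cases ps with
    | nil => simp [polyMatch]
    | cons p ps =>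
      simp only [List.map_cons, List.forall₂_cons, ← ih, ← isSome_matchPat t.2, polyMatch]
      cases matchPat t.1 t.2 p.1 <;> cases polyMatch ts ps <;> simp

/-! ## Exposed prefixes -/

abbrev Shapes := List Shape

/-- The channel (if any) and the data of an output. -/
def Out.shapes (o : Out L) : Shapes :=
  o.chan.toList.map (fun c => c.1.shape) ++ o.args.map fun d => d.1.shape

/-- The channel (if any) and the patterns of an input. -/
def Inp.shapes (i : Inp L) : Shapes :=
  i.chan.toList.map (fun c => c.1.shape) ++ i.pats.map fun p => p.1.shape

theorem Lang.Datum.ext {c d : L.Datum} (h : c.1 = d.1) : c = d := by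
  cases c; cases d; simp_all

/-- The medium alone decides whether channels are present, so the two shape lists start with a
channel both or neither, and agreement of channels becomes the first componentwise match. -/
theorem isSome_joinMatch_singleton {o : Out L} {i : Inp L} :
    (joinMatch [o] [i]).isSome ↔ List.Forall₂ Shape.Matches o.shapes i.shapes := by
  have key : (joinMatch [o] [i]).isSome ↔ o.chan = i.chan ∧ (polyMatch o.args i.pats).isSome := by
    simp only [joinMatch]
    split_ifs with h
    · cases polyMatch o.args i.pats <;> simp [h]
    · simp [h]
  rw [key, isSome_polyMatch]
  have h : o.chan.isSome ↔ i.chan.isSome := o.chan_iff.trans i.chan_iff.symm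
  unfold Out.shapes Inp.shapes
  cases ho : o.chan <;> cases hi : i.chan <;> simp_all
  intro _
  rw [Term.shape_matches_shape]
  exact ⟨fun h => h ▸ rfl, fun h => Lang.Datum.ext h⟩

theorem Out.mem_names {o : Out L} {a : Name} (h : ∃ s ∈ o.shapes, s.Mem a) : a ∈ o.names := by
  have key : ∀ l : List L.Datum, (∃ d ∈ l, a ∈ d.1.names) →
      a ∈ l.foldr (fun d s => d.1.names ∪ s) ∅ := by
    intro l
    induction l with
    | nil => simp
    | cons d l ih => simpa using Or.imp_right fun h => ih h
  obtain ⟨s, hs, ha⟩ := h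
  simp only [shapes, List.mem_append, List.mem_map, Option.mem_toList] at hs
  rw [names, Finset.mem_union]
  rcases hs with ⟨c, hc, rfl⟩ | ⟨d, hd, rfl⟩
  · left
    simpa [Option.mem_def.1 hc] using Term.mem_shape.1 ha
  · exact Or.inr (key _ ⟨d, hd, Term.mem_shape.1 ha⟩)

theorem Inp.mem_free {i : Inp L} {a : Name} (h : ∃ s ∈ i.shapes, s.Mem a) : a ∈ i.free := by
  have key : ∀ l : List L.Pattern, (∃ d ∈ l, a ∈ d.1.free) →
      a ∈ l.foldr (fun d s => d.1.free ∪ s) ∅ := by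
    intro l
    induction l with
    | nil => simp
    | cons d l ih => simpa using Or.imp_right fun h => ih h
  obtain ⟨s, hs, ha⟩ := h
  simp only [shapes, List.mem_append, List.mem_map, Option.mem_toList] at hs
  rw [free, Finset.mem_union]
  rcases hs with ⟨c, hc, rfl⟩ | ⟨d, hd, rfl⟩
  · left
    simpa [Option.mem_def.1 hc] using Term.mem_shape.1 ha
  · exact Or.inr (key _ ⟨d, hd, Pat.mem_shape.1 ha⟩)

theorem Guard.free_subset {G : Guard L} {i : Inp L} (h : i ∈ G.inputs) : i.free ⊆ G.free := by
  unfold Guard.free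
  generalize G.inputs = l at h
  induction l with
  | nil => simp at h
  | cons j l ih =>
    rcases List.mem_cons.1 h with rfl | h
    · simp
    · exact (ih h).trans (by simp)

theorem Out.shapes_subst (f : Name → Name) (o : Out L) :
    (o.subst fun a => .ofName (f a)).shapes = o.shapes.map (Shape.map fun a => some (f a)) := by
  have h : ∀ d : L.Datum, (d.subst fun a => .ofName (f a)).1.shape =
    d.1.shape.map fun a => some (f a) := fun d => Term.shape_subst f d.1
  cases ho : o.chan <;> simp [shapes, subst, ho, h]

theorem Inp.shapes_act (β f : Name → Name) (i : Inp L) :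
    (i.act β fun a => .ofName (f a)).shapes = i.shapes.map (Shape.map fun a => some (f a)) := by
  have h : ∀ d : L.Datum, (d.subst fun a => .ofName (f a)).1.shape =
    d.1.shape.map fun a => some (f a) := fun d => Term.shape_subst f d.1
  have h' : ∀ p : L.Pattern, (p.act β fun a => .ofName (f a)).1.shape =
    p.1.shape.map fun a => some (f a) := fun p => Pat.shape_act β f p.1
  cases ho : i.chan <;> simp [shapes, act, ho, h, h']

/-- An exposed prefix: an output (`true`) or an input (`false`). -/
abbrev Prefix := Bool × Shapes

namespace Prefix

def map (f : Name → Option Name) (e : Prefix) : Prefix := (e.1, e.2.map (Shape.map f))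

def Mem (a : Name) (e : Prefix) : Prop := ∃ s ∈ e.2, s.Mem a

theorem map_map (f g : Name → Option Name) (e : Prefix) :
    (e.map g).map f = e.map fun a => (g a).bind f := by
  simp [map, Shape.map_map]

theorem map_congr {f g : Name → Option Name} {e : Prefix} (h : ∀ a, e.Mem a → f a = g a) :
    e.map f = e.map g := by
  refine Prod.ext rfl (List.map_congr_left fun s hs => Shape.map_congr fun a ha => ?_)
  exact h a ⟨s, hs, ha⟩

theorem map_eq_self {f : Name → Option Name} {e : Prefix} (h : ∀ a, e.Mem a → f a = some a) :
    e.map f = e := by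
  rw [map_congr h]
  refine Prod.ext rfl ?_
  simp [map, Shape.map_some]

theorem mem_map {f : Name → Option Name} {e : Prefix} {b : Name} :
    (e.map f).Mem b ↔ ∃ a, e.Mem a ∧ f a = some b := by
  simp only [Mem, map, List.mem_map, exists_exists_and_eq_and, Shape.mem_map]
  grind

end Prefix

/-- Hide the names in a set. -/
noncomputable def hide (A : Finset Name) (a : Name) : Option Name := if a ∈ A then none else some a

/-- An output in the first set matches an input in the second. -/
def Cross (A B : Set Prefix) : Prop :=
  ∃ o i, (true, o) ∈ A ∧ (false, i) ∈ B ∧ List.Forall₂ Shape.Matches o i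

namespace Proc

open Classical in
/-- The exposed prefixes of a process. -/
noncomputable def exposed : Proc L → Set Prefix
  | nil => ∅
  | ok => ∅
  | outA _ o => {(true, o.shapes)}
  | outS _ o _ => {(true, o.shapes)}
  | inp G _ => {e | ∃ i ∈ G.inputs, e = (false, i.shapes)}
  | res a P => Prefix.map (hide {a}) '' P.exposed
  | par P Q => P.exposed ∪ Q.exposed
  | ite s t P Q => if s = t then P.exposed else Q.exposed
  | rep P => P.exposed

/-- One output of the process can interact with one input of it. -/
def Communicates : Proc L → Prop
  | nil => False
  | ok => False
  | outA _ _ => False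
  | outS _ _ _ => False
  | inp _ _ => False
  | res _ P => P.Communicates
  | par P Q => P.Communicates ∨ Q.Communicates ∨
      Cross P.exposed Q.exposed ∨ Cross Q.exposed P.exposed
  | ite s t P Q => (s = t ∧ P.Communicates) ∨ (s ≠ t ∧ Q.Communicates)
  -- Two copies of `P` may interact with each other.
  | rep P => P.Communicates ∨ Cross P.exposed P.exposed

theorem mem_fn_of_exposed {P : Proc L} {e : Prefix} (he : e ∈ P.exposed) {a : Name}
    (ha : e.Mem a) : a ∈ P.fn := by
  induction P generalizing e a with
  | nil => exact he.elim
  | ok => exact he.elim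
  | outA h o =>
    rw [Set.mem_singleton_iff.1 he] at ha
    exact Out.mem_names ha
  | outS h o P =>
    rw [Set.mem_singleton_iff.1 he] at ha
    exact Finset.mem_union_left _ (Out.mem_names ha)
  | inp G P =>
    obtain ⟨i, hi, rfl⟩ := he
    exact Finset.mem_union_left _ (Guard.free_subset hi (Inp.mem_free ha))
  | res b P ih =>
    obtain ⟨e, he, rfl⟩ := he
    obtain ⟨c, hc, hca⟩ := Prefix.mem_map.1 ha
    have := ih he hc
    unfold hide at hca
    split_ifs at hca with h
    simp_all [fn]
  | par P Q ihP ihQ =>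
    rcases he with he | he
    · exact Finset.mem_union_left _ (ihP he ha)
    · exact Finset.mem_union_right _ (ihQ he ha)
  | ite s t P Q ihP ihQ =>
    simp only [exposed] at he
    split_ifs at he
    · simp [fn, ihP he ha]
    · simp [fn, ihQ he ha]
  | rep P ih => exact ih he ha

theorem exposed_rename (π : Equiv.Perm Name) (P : Proc L) :
    (P.rename π).exposed = Prefix.map (fun a => some (π a)) '' P.exposed := by
  induction P with
  | nil => simp [rename, exposed]
  | ok => simp [rename, exposed]
  | outA h o => simp [rename, exposed, Prefix.map, Out.shapes_subst]
  | outS h o P => simp [rename, exposed, Prefix.map, Out.shapes_subst]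
  | inp G P =>
    ext e
    simp only [rename, exposed, Guard.act, List.mem_map, exists_exists_and_eq_and,
      Set.mem_ofPred_eq, Set.mem_image, Inp.shapes_act, Prefix.map]
    grind
  | res a P ih =>
    simp only [rename, exposed, ih, Set.image_image, Prefix.map_map]
    refine Set.image_congr fun e _ => Prefix.map_congr fun b _ => ?_
    by_cases h : b = a <;> simp [hide, h]
  | par P Q ihP ihQ => simp [rename, exposed, ihP, ihQ, Set.image_union]
  | ite s t P Q ihP ihQ =>
    classical
    simp only [rename, exposed, ihP, ihQ, Term.subst_perm_inj]
    split_ifs <;> rfl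
  | rep P ih => simpa [rename, exposed] using ih

end Proc

/-! ### Invariance of exposure and communication under structural equivalence -/

theorem Cross.map {A B : Set Prefix} {f g : Name → Option Name} (h : Cross A B)
    (hfg : ∀ a, (∃ e ∈ A, e.Mem a) → (∃ e ∈ B, e.Mem a) → f a = g a ∧ f a ≠ none) :
    Cross (Prefix.map f '' A) (Prefix.map g '' B) := by
  obtain ⟨o, i, ho, hi, h⟩ := h
  refine ⟨o.map (Shape.map f), i.map (Shape.map g), ⟨_, ho, rfl⟩, ⟨_, hi, rfl⟩, ?_⟩
  rw [List.forall₂_map_left_iff, List.forall₂_map_right_iff]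
  rw [List.forall₂_iff_get] at h ⊢
  refine ⟨h.1, fun n h1 h2 => (h.2 n h1 h2).map fun a ha hb => hfg a ?_ ?_⟩
  · exact ⟨_, ho, _, List.get_mem _ _, ha⟩
  · exact ⟨_, hi, _, List.get_mem _ _, hb⟩

theorem Cross.of_map {A B : Set Prefix} {f g : Name → Option Name}
    (hf : ∀ a b, f a = some b → b = a) (hg : ∀ a b, g a = some b → b = a)
    (h : Cross (Prefix.map f '' A) (Prefix.map g '' B)) : Cross A B := by
  obtain ⟨_, _, ⟨⟨_, o⟩, ho, h1⟩, ⟨⟨_, i⟩, hi, h2⟩, h⟩ := h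
  cases h1; cases h2
  rw [List.forall₂_map_left_iff, List.forall₂_map_right_iff] at h
  exact ⟨o, i, ho, hi, h.imp fun t p => Shape.Matches.of_map hf hg⟩

theorem cross_union_left {A B C : Set Prefix} : Cross (A ∪ B) C ↔ Cross A C ∨ Cross B C := by
  simp only [Cross, Set.mem_union]
  grind

theorem cross_union_right {A B C : Set Prefix} : Cross C (A ∪ B) ↔ Cross C A ∨ Cross C B := by
  simp only [Cross, Set.mem_union]
  grind

theorem hide_eq_some {A : Finset Name} (a b : Name) (h : hide A a = some b) : b = a := by
  unfold hide at h
  split_ifs at h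
  simpa using h.symm

theorem cross_perm (π : Equiv.Perm Name) {A B : Set Prefix} :
    Cross (Prefix.map (fun a => some (π a)) '' A) (Prefix.map (fun a => some (π a)) '' B) ↔
      Cross A B := by
  refine ⟨fun h => ?_, fun h => h.map fun a _ _ => ⟨rfl, by simp⟩⟩
  have := h.map (f := fun a => some (π.symm a)) (g := fun a => some (π.symm a))
    fun a _ _ => ⟨rfl, by simp⟩
  have key : ∀ e : Prefix, (e.map fun a => some a) = e := fun e => Prefix.map_eq_self fun _ _ => rfl
  simpa [Set.image_image, Prefix.map_map, key] using this

theorem Proc.communicates_rename (π : Equiv.Perm Name) (P : Proc L) :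
    (P.rename π).Communicates ↔ P.Communicates := by
  induction P <;>
    simp_all [rename, Communicates, Term.subst_perm_inj, exposed_rename, cross_perm]

/-- Restricted names are exposed as `none` and binding names as `bind`, so a change of bound names
is invisible. -/
theorem AlphaEq.exposed_eq {P Q : Proc L} (h : AlphaEq P Q) : P.exposed = Q.exposed := by
  induction h with
  | res_rename a P π h =>
    simp only [exposed, exposed_rename, Set.image_image, Prefix.map_map]
    refine Set.image_congr fun e he => Prefix.map_congr fun b hb => ?_
    have hb := mem_fn_of_exposed he hb
    rcases eq_or_ne b a with rfl | hba
    · simp [hide]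
    · have h1 := h b (by simp [hb, hba])
      have h2 : b ≠ π a := fun e => hba (π.injective (h1.trans e))
      simp [hide, hba, h1, h2]
  | inp_rename G P π h =>
    ext e
    have key : ∀ i : Inp L, (i.act π .ofName).shapes = i.shapes := fun i =>
      (Inp.shapes_act π id i).trans (by simp [Shape.map_some, Function.id_def])
    simp [exposed, Guard.act, key]
  | _ => simp_all [exposed]

theorem AlphaEq.communicates_iff {P Q : Proc L} (h : AlphaEq P Q) :
    P.Communicates ↔ Q.Communicates := by
  induction h with
  | res_rename a P π h => simp [Communicates, communicates_rename]
  | symm _ ih => exact ih.symm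
  | trans _ _ ih ih' => exact ih.trans ih'
  | par h h' ih ih' => simp [Communicates, ih, ih', h.exposed_eq, h'.exposed_eq]
  | rep h ih => simp [Communicates, ih, h.exposed_eq]
  | _ => simp_all [Communicates]

theorem Proc.exposed_hide_of_notMem {P : Proc L} {a : Name} (h : a ∉ P.fn) :
    Prefix.map (hide {a}) '' P.exposed = P.exposed := by
  have : ∀ e ∈ P.exposed, Prefix.map (hide {a}) e = id e := fun e he =>
    Prefix.map_eq_self fun b hb => by
      have hb := mem_fn_of_exposed he hb
      have : b ≠ a := fun e => h (e ▸ hb)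
      simp [hide, this]
  rw [Set.image_congr this, Set.image_id]

theorem StructEq.exposed_eq {P Q : Proc L} (h : StructEq P Q) : P.exposed = Q.exposed := by
  induction h with
  | alpha h => exact h.exposed_eq
  | par_comm P Q => exact Set.union_comm _ _
  | par_assoc P Q R => exact (Set.union_assoc _ _ _).symm
  | res_comm a b P =>
    simp only [exposed, Set.image_image, Prefix.map_map]
    refine Set.image_congr fun e _ => Prefix.map_congr fun c _ => ?_
    by_cases h : c = a <;> by_cases h' : c = b <;> simp [hide, h, h']
    all_goals split_ifs <;> simp_all [hide]
  | res_par a P Q h => simp only [exposed, Set.image_union, exposed_hide_of_notMem h]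
  | _ => simp_all [exposed]

theorem StructEq.communicates_iff {P Q : Proc L} (h : StructEq P Q) :
    P.Communicates ↔ Q.Communicates := by
  induction h with
  | alpha h => exact h.communicates_iff
  | symm _ ih => exact ih.symm
  | trans _ _ ih ih' => exact ih.trans ih'
  | par h h' ih ih' => simp [Communicates, ih, ih', h.exposed_eq, h'.exposed_eq]
  | rep h ih => simp [Communicates, ih, h.exposed_eq]
  | par_nil P => simp [Communicates, exposed, Cross]
  | par_comm P Q => simp only [Communicates]; tauto
  | par_assoc P Q R =>
    simp only [Communicates, exposed, cross_union_left, cross_union_right]; tauto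
  | rep_unfold P => simp only [Communicates, exposed]; tauto
  | res_par a P Q h =>
    -- Scope extrusion: `a` does not occur in `P`, so hiding it on both sides neither creates nor
    -- destroys a match between `P` and `Q`.
    have key : ∀ e : Name, (∃ e' ∈ P.exposed, e'.Mem e) → hide {a} e = some e := by
      rintro b ⟨e, he, hb⟩
      have hb := mem_fn_of_exposed he hb
      have : b ≠ a := fun e => h (e ▸ hb)
      simp [hide, this]
    have h1 : Cross P.exposed (Prefix.map (hide {a}) '' Q.exposed) ↔
        Cross P.exposed Q.exposed := by
      rw [← exposed_hide_of_notMem h]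
      refine ⟨fun h' => ?_, fun h' => ?_⟩
      · rw [exposed_hide_of_notMem h]
        exact h'.of_map hide_eq_some hide_eq_some
      · rw [exposed_hide_of_notMem h] at h'
        exact h'.map fun b hb _ => ⟨rfl, by simp [key b hb]⟩
    have h2 : Cross (Prefix.map (hide {a}) '' Q.exposed) P.exposed ↔
        Cross Q.exposed P.exposed := by
      rw [← exposed_hide_of_notMem h]
      refine ⟨fun h' => ?_, fun h' => ?_⟩
      · rw [exposed_hide_of_notMem h]
        exact h'.of_map hide_eq_some hide_eq_some
      · rw [exposed_hide_of_notMem h] at h'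
        exact h'.map fun b _ hb => ⟨rfl, by simp [key b hb]⟩
    simp [Communicates, exposed, h1, h2]
  | _ => simp_all [Communicates]

/-! ## Reduction in binary languages is communication between two exposed prefixes -/

theorem Proc.communicates_of_joinMatch (hL : L.coord = .binary) {os : List (Out L)} {Os : Proc L}
    {G : Guard L} {Q : Proc L} {σ} (hσ : joinMatch os G.inputs = some σ)
    (hO : ∀ o ∈ os, (true, o.shapes) ∈ Os.exposed) : (Proc.par Os (Proc.inp G Q)).Communicates := by
  obtain ⟨i, hi⟩ := List.length_eq_one_iff.1 (G.binary hL)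
  obtain ⟨o, ho⟩ := List.length_eq_one_iff.1 ((joinMatch_length hσ).trans (G.binary hL))
  rw [ho, hi] at hσ
  refine Or.inr (Or.inr (Or.inl
    ⟨o.shapes, i.shapes, hO o (by simp [ho]), ⟨i, by simp [hi], rfl⟩, ?_⟩))
  exact isSome_joinMatch_singleton.1 (by simp [hσ])

theorem Proc.exposed_subset_parAll {Ps : List (Proc L)} {P : Proc L} (h : P ∈ Ps) :
    P.exposed ⊆ (parAll Ps).exposed := by
  induction Ps with
  | nil => simp at h
  | cons Q Ps ih =>
    rcases List.mem_cons.1 h with rfl | h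
    · exact Set.subset_union_left
    · exact (ih h).trans Set.subset_union_right

theorem Red.communicates (hL : L.coord = .binary) {P Q : Proc L} (h : Red P Q) :
    P.Communicates := by
  induction h with
  | commA h os G Q σ hσ =>
    exact communicates_of_joinMatch hL hσ fun o ho =>
      exposed_subset_parAll (List.mem_map.2 ⟨o, ho, rfl⟩) rfl
  | commS h es G Q σ hσ =>
    refine communicates_of_joinMatch hL hσ fun o ho => ?_
    obtain ⟨e, he, rfl⟩ := List.mem_map.1 ho
    exact exposed_subset_parAll (List.mem_map.2 ⟨e, he, rfl⟩) rfl
  | par Q _ ih => exact Or.inl ih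
  | res a _ ih => exact ih
  | struct h _ _ ih => exact h.communicates_iff.2 ih

/-! ### Scope extrusion: exposed prefixes that match do react -/

namespace Proc

/-- Restriction of a list of names. -/
def resAll (A : List Name) (P : Proc L) : Proc L := A.foldr res P

/-- An output or input process with the given exposed prefix. -/
inductive IsPrefix : Proc L → Prefix → Prop
  | outA (h o) : IsPrefix (outA h o) (true, o.shapes)
  | outS (h o P) : IsPrefix (outS h o P) (true, o.shapes)
  | inp (G P i) (h : i ∈ G.inputs) : IsPrefix (inp G P) (false, i.shapes)

theorem IsPrefix.rename {P : Proc L} {e : Prefix} (h : IsPrefix P e) (π : Equiv.Perm Name) :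
    IsPrefix (P.rename π) (e.map fun a => some (π a)) := by
  cases h with
  | outA h o =>
    rw [Prefix.map, ← Out.shapes_subst]
    exact .outA _ _
  | outS h o P =>
    rw [Prefix.map, ← Out.shapes_subst]
    exact .outS _ _ _
  | inp G P i h =>
    rw [Prefix.map, ← Inp.shapes_act π]
    exact .inp _ _ _ (List.mem_map.2 ⟨i, h, rfl⟩)

theorem IsPrefix.mem_exposed {P : Proc L} {e : Prefix} (h : IsPrefix P e) : e ∈ P.exposed := by
  cases h with
  | outA h o => rfl
  | outS h o P => rfl
  | inp G P i h => exact ⟨i, h, rfl⟩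

theorem rename_resAll (π : Equiv.Perm Name) (A : List Name) (P : Proc L) :
    (resAll A P).rename π = resAll (A.map π) (P.rename π) := by
  induction A with
  | nil => rfl
  | cons a A ih => simpa [resAll, rename] using ih

theorem _root_.Coordination.StructEq.resAll {P Q : Proc L} (h : StructEq P Q) (A : List Name) :
    StructEq (resAll A P) (resAll A Q) := by
  induction A with
  | nil => exact h
  | cons a A ih => exact ih.res a

theorem structEq_par_resAll {A : List Name} {P : Proc L} (h : ∀ a ∈ A, a ∉ P.fn) (Q : Proc L) :
    StructEq (par P (resAll A Q)) (resAll A (par P Q)) := by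
  induction A with
  | nil => exact .refl _
  | cons a A ih =>
    exact (StructEq.res_par a P _ (h a (by simp))).trans
      ((ih fun b hb => h b (by simp [hb])).res a)

theorem structEq_resAll_par {A : List Name} {P : Proc L} (h : ∀ a ∈ A, a ∉ P.fn) (Q : Proc L) :
    StructEq (par (resAll A Q) P) (resAll A (par Q P)) :=
  (StructEq.par_comm _ _).trans ((structEq_par_resAll h Q).trans ((StructEq.par_comm _ _).resAll A))

/-- The prefix `e` can be brought to the top of `P`, under restrictions of names that avoid `X`. -/
def Extrudes (P : Proc L) (e : Prefix) (X : Finset Name) : Prop :=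
  ∃ (A : List Name) (O R : Proc L) (e' : Prefix), IsPrefix O e' ∧ (∀ a ∈ A, a ∉ X) ∧
    e = e'.map (hide A.toFinset) ∧ StructEq P (resAll A (par O R))

theorem IsPrefix.extrudes {P : Proc L} {e : Prefix} (h : IsPrefix P e) (X : Finset Name) :
    P.Extrudes e X :=
  ⟨[], P, nil, e, h, by simp, (Prefix.map_eq_self fun _ _ => by simp [hide]).symm,
    (StructEq.par_nil P).symm⟩

theorem Extrudes.structEq {P Q : Proc L} {e : Prefix} {X : Finset Name} (h : Q.Extrudes e X)
    (hPQ : StructEq P Q) : P.Extrudes e X :=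
  let ⟨A, O, R, e', hO, hA, he, hQ⟩ := h
  ⟨A, O, R, e', hO, hA, he, hPQ.trans hQ⟩

/-- Restrictions that avoid `Q.fn` can be widened over `Q`; this is why `Extrudes` carries a set of
names to avoid. -/
theorem Extrudes.par {P Q : Proc L} {e : Prefix} {X : Finset Name} (h : P.Extrudes e (X ∪ Q.fn)) :
    (par P Q).Extrudes e X := by
  obtain ⟨A, O, R, e', hO, hA, he, hP⟩ := h
  refine ⟨A, O, Proc.par R Q, e', hO, fun a ha h => hA a ha (by simp [h]), he, ?_⟩
  exact (hP.par (.refl Q)).trans ((structEq_resAll_par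
    (fun a ha h => hA a ha (by simp [h])) _).trans ((StructEq.par_assoc _ _ _).symm.resAll A))

theorem Extrudes.res {P : Proc L} {e : Prefix} {X : Finset Name} {a : Name}
    (h : P.Extrudes e (insert a X)) : (res a P).Extrudes (e.map (hide {a})) X := by
  obtain ⟨A, O, R, e', hO, hA, rfl, hP⟩ := h
  -- `a` itself may lie in `X`, so it is swapped with a fresh `b`: fresh for `A`, so that the swap
  -- fixes `A`; for `O`, so that hiding `b` hides no other name of the prefix; for the whole body,
  -- so that the swap is an alpha-conversion.
  obtain ⟨b, hb⟩ := Infinite.exists_notMem_finset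
    (X ∪ A.toFinset ∪ O.fn ∪ (resAll A (Proc.par O R)).fn)
  simp only [Finset.mem_union, not_or, List.mem_toFinset] at hb
  obtain ⟨⟨⟨hbX, hbA⟩, hbO⟩, hbR⟩ := hb
  have haA : a ∉ A := fun h => hA a h (by simp)
  have hAmap : A.map (Equiv.swap a b) = A := by
    refine (List.map_congr_left fun c hc => ?_).trans (List.map_id A)
    exact Equiv.swap_apply_of_ne_of_ne (fun h => haA (h ▸ hc)) (fun h => hbA (h ▸ hc))
  refine ⟨b :: A, O.rename (Equiv.swap a b), R.rename (Equiv.swap a b), _, hO.rename _, ?_, ?_, ?_⟩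
  · intro c hc
    rcases List.mem_cons.1 hc with rfl | hc
    · exact hbX
    · exact fun h => hA c hc (by simp [h])
  · rw [Prefix.map_map, Prefix.map_map]
    refine Prefix.map_congr fun c hc => ?_
    have hcb : c ≠ b := fun h => hbO (h ▸ mem_fn_of_exposed hO.mem_exposed hc)
    rcases eq_or_ne c a with rfl | hca
    · simp [hide, haA]
    · rw [Equiv.swap_apply_of_ne_of_ne hca hcb]
      by_cases hcA : c ∈ A <;> simp [hide, hcA, hca, hcb]
  · have := AlphaEq.res_rename a (resAll A (Proc.par O R)) (Equiv.swap a b) (fun c hc => by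
      simp only [Finset.mem_sdiff, Finset.mem_singleton] at hc
      exact Equiv.swap_apply_of_ne_of_ne hc.2 (fun h => hbR (h ▸ hc.1)))
    rw [Equiv.swap_apply_left, rename_resAll, hAmap] at this
    exact (hP.res a).trans (.alpha this)

/-- Restrictions are pulled outwards and replications unfolded along the path to the prefix. The set
`X` must vary in the induction, as it grows at parallel compositions and restrictions. -/
theorem extrudes_of_mem_exposed {P : Proc L} {e : Prefix} (he : e ∈ P.exposed)
    (X : Finset Name) : P.Extrudes e X := by
  induction P generalizing e X with
  | nil => exact he.elim
  | ok => exact he.elim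
  | outA h o =>
    rw [Set.mem_singleton_iff.1 he]
    exact (IsPrefix.outA _ _).extrudes X
  | outS h o P =>
    rw [Set.mem_singleton_iff.1 he]
    exact (IsPrefix.outS _ _ _).extrudes X
  | inp G P =>
    obtain ⟨i, hi, rfl⟩ := he
    exact (IsPrefix.inp _ _ _ hi).extrudes X
  | res a P ih =>
    obtain ⟨e, he, rfl⟩ := he
    exact (ih he _).res
  | par P Q ihP ihQ =>
    rcases he with he | he
    · exact (ihP he _).par
    · exact (ihQ he _).par.structEq (.par_comm _ _)
  | ite s t P Q ihP ihQ =>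
    by_cases h : s = t
    · exact (ihP (by simpa [exposed, h] using he) X).structEq (.ite_pos _ _ _ _ h)
    · exact (ihQ (by simpa [exposed, h] using he) X).structEq (.ite_neg _ _ _ _ h)
  | rep P ih => exact (ih he _).par.structEq (.rep_unfold P)

theorem Reduces.structEq {P Q : Proc L} (h : Q.Reduces) (hPQ : StructEq P Q) : P.Reduces :=
  let ⟨_, h⟩ := h
  ⟨_, .struct hPQ h (.refl _)⟩

theorem Reduces.par {P : Proc L} (h : P.Reduces) (Q : Proc L) : (Proc.par P Q).Reduces :=
  let ⟨_, h⟩ := h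
  ⟨_, .par Q h⟩

theorem Reduces.par_right {Q : Proc L} (h : Q.Reduces) (P : Proc L) : (Proc.par P Q).Reduces :=
  (h.par P).structEq (.par_comm _ _)

theorem Reduces.res {P : Proc L} (h : P.Reduces) (a : Name) : (Proc.res a P).Reduces :=
  let ⟨_, h⟩ := h
  ⟨_, .res a h⟩

theorem Reduces.resAll {P : Proc L} (h : P.Reduces) (A : List Name) :
    (Proc.resAll A P).Reduces := by
  induction A with
  | nil => exact h
  | cons a A ih => exact ih.res a

theorem reduces_of_isPrefix (hL : L.coord = .binary) {O I : Proc L} {o i : Shapes}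
    (hO : IsPrefix O (true, o)) (hI : IsPrefix I (false, i))
    (h : List.Forall₂ Shape.Matches o i) : (par O I).Reduces := by
  cases hI with
  | inp G Q i hi =>
    obtain ⟨j, hj⟩ := List.length_eq_one_iff.1 (G.binary hL)
    obtain rfl : i = j := by simpa [hj] using hi
    cases hO with
    | outA hs o =>
      obtain ⟨σ, hσ⟩ := Option.isSome_iff_exists.1 (isSome_joinMatch_singleton.2 h)
      exact Reduces.structEq ⟨_, Red.commA hs [o] G Q σ (hj ▸ hσ)⟩
        ((StructEq.par_nil _).symm.par (.refl _))
    | outS hs o P =>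
      obtain ⟨σ, hσ⟩ := Option.isSome_iff_exists.1 (isSome_joinMatch_singleton.2 h)
      exact Reduces.structEq ⟨_, Red.commS hs [(o, P)] G Q σ (hj ▸ hσ)⟩
        ((StructEq.par_nil _).symm.par (.refl _))

theorem reduces_of_cross (hL : L.coord = .binary) {P Q : Proc L}
    (h : Cross P.exposed Q.exposed) : (par P Q).Reduces := by
  obtain ⟨o, i, ho, hi, h⟩ := h
  obtain ⟨A, O, R, ⟨b, o'⟩, hO, hA, he, hP⟩ := extrudes_of_mem_exposed ho Q.fn
  -- `B` avoids the already extruded `O` and `R`, so both blocks of restrictions can enclose the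
  -- whole composition.
  obtain ⟨B, I, R', ⟨b', i'⟩, hI, hB, he', hQ⟩ := extrudes_of_mem_exposed hi (par O R).fn
  simp only [Prefix.map, Prod.mk.injEq] at he he'
  obtain ⟨rfl, rfl⟩ := he
  obtain ⟨rfl, rfl⟩ := he'
  rw [List.forall₂_map_left_iff, List.forall₂_map_right_iff] at h
  have hOI := reduces_of_isPrefix hL hO hI
    (h.imp fun t p => Shape.Matches.of_map hide_eq_some hide_eq_some)
  have e1 : StructEq (par (par O R) (par I R')) (par (par O I) (par R R')) :=
    (StructEq.par_assoc _ _ _).trans ((StructEq.par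
      ((StructEq.par_assoc O R I).symm.trans (((StructEq.refl O).par (.par_comm R I)).trans
        (.par_assoc O I R))) (.refl R')).trans (StructEq.par_assoc _ _ _).symm)
  refine (((hOI.par _).structEq e1).resAll B).resAll A |>.structEq ?_
  exact (hP.par (.refl Q)).trans ((structEq_resAll_par hA _).trans
    ((((StructEq.refl _).par hQ).trans (structEq_par_resAll hB _)).resAll A))

theorem Communicates.reduces (hL : L.coord = .binary) {P : Proc L} (h : P.Communicates) :
    P.Reduces := by
  induction P with
  | res a P ih => exact (ih h).res a
  | par P Q ihP ihQ =>
    rcases h with h | h | h | h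
    · exact (ihP h).par Q
    · exact (ihQ h).par_right P
    · exact reduces_of_cross hL h
    · exact (reduces_of_cross hL h).structEq (.par_comm _ _)
  | ite s t P Q ihP ihQ =>
    rcases h with ⟨e, h⟩ | ⟨e, h⟩
    · exact (ihP h).structEq (.ite_pos _ _ _ _ e)
    · exact (ihQ h).structEq (.ite_neg _ _ _ _ e)
  | rep P ih =>
    rcases h with h | h
    · exact ((ih h).par _).structEq (.rep_unfold P)
    -- Two unfoldings supply the copy that sends and the copy that receives.
    · exact ((reduces_of_cross hL h).par (rep P)).structEq ((StructEq.rep_unfold P).trans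
        (((StructEq.refl P).par (.rep_unfold P)).trans (.par_assoc _ _ _)))
  | _ => exact h.elim

theorem reduces_iff_communicates (hL : L.coord = .binary) {P : Proc L} :
    P.Reduces ↔ P.Communicates :=
  ⟨fun ⟨_, h⟩ => h.communicates hL, Communicates.reduces hL⟩

end Proc

/-! ## At most two components take part in a communication -/

/-- An exposed prefix and top-level success of `F S` depend on one component of `S`, and a
communication depends on two. -/
structure IsLocal {ι : Type*} (F : (ι → Proc L) → Proc L) : Prop where
  exposed : ∀ S, ∀ e ∈ (F S).exposed, ∃ i, ∀ S', S' i = S i → e ∈ (F S').exposed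
  hasOk : ∀ S, (F S).HasOk → ∃ i, ∀ S', S' i = S i → (F S').HasOk
  communicates : ∀ S, (F S).Communicates →
    ∃ i j, ∀ S', S' i = S i → S' j = S j → (F S').Communicates

namespace IsLocal

variable {ι : Type*} {F G : (ι → Proc L) → Proc L}

theorem proj (i : ι) : IsLocal fun S : ι → Proc L => S i where
  exposed S e he := ⟨i, fun S' h => by rwa [h]⟩
  hasOk S he := ⟨i, fun S' h => by rwa [h]⟩
  communicates S he := ⟨i, i, fun S' h _ => by rwa [h]⟩

theorem const [Nonempty ι] (P : Proc L) : IsLocal fun _ : ι → Proc L => P where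
  exposed _ _ he := ⟨Classical.arbitrary ι, fun _ _ => he⟩
  hasOk _ h := ⟨Classical.arbitrary ι, fun _ _ => h⟩
  communicates _ h := ⟨Classical.arbitrary ι, Classical.arbitrary ι, fun _ _ _ => h⟩

theorem cross (hF : IsLocal F) (hG : IsLocal G) {S : ι → Proc L}
    (h : Cross (F S).exposed (G S).exposed) :
    ∃ i j, ∀ S', S' i = S i → S' j = S j → Cross (F S').exposed (G S').exposed := by
  obtain ⟨o, i, ho, hi, h⟩ := h
  obtain ⟨m, hm⟩ := hF.exposed S _ ho
  obtain ⟨n, hn⟩ := hG.exposed S _ hi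
  exact ⟨m, n, fun S' h1 h2 => ⟨o, i, hm S' h1, hn S' h2, h⟩⟩

/-- For components below a prefix: what is exposed is the prefix itself, whatever its continuation.
-/
theorem of_inert [Nonempty ι] (hexp : ∀ S S', (F S).exposed ⊆ (F S').exposed)
    (hok : ∀ S, ¬ (F S).HasOk) (hcom : ∀ S, ¬ (F S).Communicates) : IsLocal F where
  exposed S _ he := ⟨Classical.arbitrary ι, fun S' _ => hexp S S' he⟩
  hasOk S h := (hok S h).elim
  communicates S h := (hcom S h).elim

theorem res (hF : IsLocal F) (a : Name) : IsLocal fun S => .res a (F S) where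
  exposed S e he := by
    obtain ⟨e, he, rfl⟩ := he
    obtain ⟨i, hi⟩ := hF.exposed S e he
    exact ⟨i, fun S' h => ⟨e, hi S' h, rfl⟩⟩
  hasOk := hF.hasOk
  communicates := hF.communicates

theorem par (hF : IsLocal F) (hG : IsLocal G) : IsLocal fun S => .par (F S) (G S) where
  exposed S e he := by
    rcases he with he | he
    · exact (hF.exposed S e he).imp fun i hi S' h => Or.inl (hi S' h)
    · exact (hG.exposed S e he).imp fun i hi S' h => Or.inr (hi S' h)
  hasOk S h := by
    rcases h with h | h
    · exact (hF.hasOk S h).imp fun i hi S' h => Or.inl (hi S' h)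
    · exact (hG.hasOk S h).imp fun i hi S' h => Or.inr (hi S' h)
  communicates S h := by
    rcases h with h | h | h | h
    · obtain ⟨i, j, hij⟩ := hF.communicates S h
      exact ⟨i, j, fun S' h h' => Or.inl (hij S' h h')⟩
    · obtain ⟨i, j, hij⟩ := hG.communicates S h
      exact ⟨i, j, fun S' h h' => Or.inr (Or.inl (hij S' h h'))⟩
    · obtain ⟨i, j, hij⟩ := hF.cross hG h
      exact ⟨i, j, fun S' h h' => Or.inr (Or.inr (Or.inl (hij S' h h')))⟩
    · obtain ⟨i, j, hij⟩ := hG.cross hF h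
      exact ⟨i, j, fun S' h h' => Or.inr (Or.inr (Or.inr (hij S' h h')))⟩

theorem ite (hF : IsLocal F) (hG : IsLocal G) (s t : Term) :
    IsLocal fun S => .ite s t (F S) (G S) := by
  by_cases h : s = t
  · exact ⟨by simpa [Proc.exposed, h] using hF.exposed, by simpa [HasOk, h] using hF.hasOk,
      by simpa [Communicates, h] using hF.communicates⟩
  · exact ⟨by simpa [Proc.exposed, h] using hG.exposed, by simpa [HasOk, h] using hG.hasOk,
      by simpa [Communicates, h] using hG.communicates⟩

/-- Replication multiplies copies, not components: the output and the input that meet still stem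
from one component each. -/
theorem rep (hF : IsLocal F) : IsLocal fun S => .rep (F S) where
  exposed := hF.exposed
  hasOk := hF.hasOk
  communicates S h := by
    rcases h with h | h
    · obtain ⟨i, j, hij⟩ := hF.communicates S h
      exact ⟨i, j, fun S' h h' => Or.inl (hij S' h h')⟩
    · obtain ⟨i, j, hij⟩ := hF.cross hF h
      exact ⟨i, j, fun S' h h' => Or.inr (hij S' h h')⟩

theorem parAll [Nonempty ι] (l : List ι) : IsLocal fun S : ι → Proc L => Proc.parAll (l.map S) := by
  induction l with
  | nil => exact const _
  | cons i l ih => exact (proj i).par ih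

theorem fill [Nonempty ι] {k : ℕ} (C : Ctx L k) {F : Fin k → (ι → Proc L) → Proc L}
    (hF : ∀ i, IsLocal (F i)) : IsLocal fun S => C.fill fun i => F i S := by
  induction C with
  | hole i => exact hF i
  | op o args ih =>
    cases o with
    | nil => exact const _
    | ok => exact const _
    | outA h o => exact const _
    | outS h o => exact of_inert (fun _ _ => subset_rfl) (fun _ => id) (fun _ => id)
    | inp G => exact of_inert (fun _ _ => subset_rfl) (fun _ => id) (fun _ => id)
    | res a => exact (ih (0 : Fin 1)).res a
    | par => exact (ih (0 : Fin 2)).par (ih (1 : Fin 2))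
    | ite s t => exact (ih (0 : Fin 2)).ite (ih (1 : Fin 2)) s t
    | rep => exact (ih (0 : Fin 1)).rep

end IsLocal

/-! ## The coordination degree -/

theorem exists_ne_and_ne {n : ℕ} (hn : 2 < n) (i j : Fin n) : ∃ l, l ≠ i ∧ l ≠ j := by
  by_contra! h
  have : (Finset.univ : Finset (Fin n)) ⊆ {i, j} := fun l _ => by
    rcases eq_or_ne l i with hl | hl
    · simp [hl]
    · simp [h l hl]
  have := (Finset.card_le_card this).trans Finset.card_le_two
  simp only [Finset.card_univ, Fintype.card_fin] at this
  omega

/-- Among more than two processes, some `l` takes no part in the communication and can be replaced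
by `nil`. -/
theorem Lang.cood_le_two (hL : L.coord = .binary) : L.cood ≤ 2 := by
  refine iSup₂_le fun n ⟨S, hS, hn⟩ => ?_
  by_contra! h
  replace h : 2 < n := by exact_mod_cast h
  have : Nonempty (Fin n) := ⟨⟨0, by omega⟩⟩
  have hF := IsLocal.parAll (L := L) (List.finRange n)
  simp only [← List.ofFn_eq_map] at hF
  obtain ⟨i, j, hij⟩ := hF.communicates S ((reduces_iff_communicates hL).1 hS)
  obtain ⟨l, hi, hj⟩ := exists_ne_and_ne h i j
  exact hn l ((reduces_iff_communicates hL).2 (hij _ (by simp [hi.symm]) (by simp [hj.symm])))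

/-! ### A receiver and its senders: lower bounds for the coordination degree -/

namespace Lang

/-- The channel `0` in the channel-based languages. -/
def chanZero (L : Lang) : Option L.Datum :=
  match L.medium with
  | .dataspace => none
  | .channel => some (.ofName 0)

theorem isSome_chanZero (L : Lang) : L.chanZero.isSome ↔ L.medium = .channel := by
  unfold chanZero
  cases L.medium <;> simp

def outZero (L : Lang) : Out L where
  chan := L.chanZero
  args := [.ofName 0]
  chan_iff := L.isSome_chanZero
  arity _ := rfl

def inpBind (L : Lang) (x : Name) : Inp L where
  chan := L.chanZero
  pats := [⟨.bind x, fun _ => trivial, fun _ => trivial⟩]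
  chan_iff := L.isSome_chanZero
  arity _ := rfl

/-- A join of `n` inputs. -/
def joinGuard (L : Lang) (n : ℕ) (h0 : n ≠ 0) (hn : L.coord = .binary → n = 1) : Guard L where
  inputs := (List.range n).map L.inpBind
  ne_nil := by simpa using h0
  binary := by simpa using hn
  nodup := by
    have : ∀ x, (L.inpBind x).binders = [x] := fun x => rfl
    simp [List.flatMap_map, this, List.nodup_range]

def sender (L : Lang) : Proc L :=
  match h : L.sync with
  | .asynchronous => .outA h L.outZero
  | .synchronous => .outS h L.outZero .nil

/-- A process that succeeds after receiving from `n` senders; the conditional makes `0` free. -/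
def receiver (L : Lang) (n : ℕ) (h0 : n ≠ 0) (hn : L.coord = .binary → n = 1) : Proc L :=
  .ite (.name 0) (.name 0) (.inp (L.joinGuard n h0 hn) .ok) .nil

/-- A receiver and `n` senders. -/
def team (L : Lang) (n : ℕ) (h0 : n ≠ 0) (hn : L.coord = .binary → n = 1) :
    Fin (n + 1) → Proc L :=
  Fin.cons (L.receiver n h0 hn) fun _ => L.sender

theorem sender_eq (L : Lang) : (∃ h, L.sender = .outA h L.outZero) ∨
    ∃ h, L.sender = .outS h L.outZero .nil := by
  unfold sender
  split
  · exact Or.inl ⟨‹_›, rfl⟩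
  · exact Or.inr ⟨‹_›, rfl⟩

theorem chanZero_names (L : Lang) : L.chanZero.elim ∅ (fun c => c.1.names) ⊆ {0} := by
  unfold chanZero
  cases L.medium <;> simp [Datum.ofName, Term.names]

theorem sender_fn (L : Lang) : L.sender.fn = {0} := by
  have h : L.outZero.names = {0} := by
    simpa [outZero, Out.names, Datum.ofName, Term.names, -Finset.union_singleton,
      Finset.union_eq_right] using L.chanZero_names
  rcases L.sender_eq with ⟨hs, h'⟩ | ⟨hs, h'⟩ <;> simp [h', fn, h]

variable {n : ℕ} {h0 : n ≠ 0} {hn : L.coord = .binary → n = 1}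

theorem receiver_fn : (L.receiver n h0 hn).fn = {0} := by
  have h : (L.joinGuard n h0 hn).free ⊆ {0} := by
    change ((List.range n).map L.inpBind).foldr (fun i s => Inp.free i ∪ s) (∅ : Finset Name) ⊆ {0}
    generalize List.range n = l
    induction l with
    | nil => simp
    | cons x l ih =>
      refine Finset.union_subset ?_ ih
      simpa [Inp.free, inpBind, Pat.free, -Finset.subset_singleton_iff] using L.chanZero_names
  simpa [receiver, fn, Term.names, -Finset.singleton_union, -Finset.union_singleton,
    Finset.union_eq_left] using h

/-- Compositionality provides one context per set of free names, so all components are given the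
same set. -/
theorem team_fn (i : Fin (n + 1)) : (L.team n h0 hn i).fn = {0} := by
  cases i using Fin.cases with
  | zero => exact receiver_fn
  | succ i => exact L.sender_fn

theorem team_not_hasOk (i : Fin (n + 1)) : ¬ (L.team n h0 hn i).HasOk := by
  cases i using Fin.cases with
  | zero => simp [team, receiver, HasOk]
  | succ i => rcases L.sender_eq with ⟨hs, h'⟩ | ⟨hs, h'⟩ <;> simp [team, h', HasOk]

theorem sender_outCount (L : Lang) : L.sender.outCount = 1 := by
  rcases L.sender_eq with ⟨hs, h'⟩ | ⟨hs, h'⟩ <;> simp [h', outCount]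

theorem sender_demand (L : Lang) : L.sender.demand = ⊤ := by
  rcases L.sender_eq with ⟨hs, h'⟩ | ⟨hs, h'⟩ <;> simp [h', demand]

theorem isSome_joinMatch_replicate (L : Lang) (l : List Name) :
    (joinMatch (List.replicate l.length L.outZero) (l.map L.inpBind)).isSome := by
  induction l with
  | nil => rfl
  | cons x l ih =>
    obtain ⟨σ, hσ⟩ := Option.isSome_iff_exists.1 ih
    have hp : polyMatch L.outZero.args (L.inpBind x).pats = some [(x, .ofName 0)] := by
      simp [outZero, inpBind, polyMatch, Datum.ofName, matchPat]
    have hc : L.outZero.chan = (L.inpBind x).chan := rfl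
    simp [List.replicate_succ, joinMatch, hσ, hp, hc]

theorem exists_red_team : ∃ P, Red (parAll (List.ofFn (L.team n h0 hn))) P ∧ P.HasOk := by
  have hofn : List.ofFn (L.team n h0 hn) = L.receiver n h0 hn :: List.replicate n L.sender := by
    simp [team, List.ofFn_succ]
  obtain ⟨σ, hσ⟩ := Option.isSome_iff_exists.1 (L.isSome_joinMatch_replicate (List.range n))
  rw [List.length_range] at hσ
  have e : StructEq (parAll (List.ofFn (L.team n h0 hn)))
      (par (parAll (List.replicate n L.sender)) (inp (L.joinGuard n h0 hn) ok)) := by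
    rw [hofn]
    exact ((StructEq.ite_pos _ _ _ _ rfl).par (.refl _)).trans (.par_comm _ _)
  rcases L.sender_eq with ⟨hs, h'⟩ | ⟨hs, h'⟩
  · have hr := Red.commA hs (List.replicate n L.outZero) (L.joinGuard n h0 hn) ok σ hσ
    rw [List.map_replicate, ← h'] at hr
    exact ⟨_, .struct e hr (.refl _), by simp [Proc.subst, HasOk]⟩
  · have hr := Red.commS hs (List.replicate n (L.outZero, nil)) (L.joinGuard n h0 hn) ok σ
      (by rwa [List.map_replicate])
    rw [List.map_replicate, ← h'] at hr
    exact ⟨_, .struct e hr (.refl _), Or.inr (by simp [Proc.subst, HasOk])⟩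

/-- By `Red.demand_le`: without the receiver the demand is `⊤` against finitely many outputs;
without a sender, `n` outputs are demanded and `n - 1` are present. The inert `Z` is `nil` for the
coordination degree and a process with free name `0` for the main theorem. -/
theorem not_reduces_update_team {Z : Proc L} (hd : Z.demand = ⊤) (hc : Z.outCount = 0)
    (j : Fin (n + 1)) : ¬ (parAll (List.ofFn (Function.update (L.team n h0 hn) j Z))).Reduces := by
  rintro ⟨P, h⟩
  replace h := h.demand_le
  have hle : ∀ i, (L.team n h0 hn i).outCount = if i = 0 then 0 else 1 := fun i => by
    cases i using Fin.cases with
    | zero => simp [team, receiver, outCount]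
    | succ i => simp [team, sender_outCount, Fin.succ_ne_zero]
  have hde : ∀ i, (L.team n h0 hn i).demand = if i = 0 then (n : ℕ∞) else ⊤ := fun i => by
    cases i using Fin.cases with
    | zero => simp [team, receiver, demand, joinGuard]
    | succ i => simp [team, sender_demand, Fin.succ_ne_zero]
  have hsum : ∑ i, (L.team n h0 hn i).outCount = n := by
    simp [Fin.sum_univ_succ, hle, Fin.succ_ne_zero]
  rw [outCount_parAll, List.map_ofFn, List.sum_ofFn] at h
  -- Stated additively to avoid subtraction in `ℕ∞`.
  have hupd : ∑ i, (outCount ∘ Function.update (L.team n h0 hn) j Z) i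
      + (L.team n h0 hn j).outCount = n := by
    rw [← hsum, ← Finset.sum_erase_add _ _ (Finset.mem_univ j),
      ← Finset.sum_erase_add _ _ (Finset.mem_univ j)]
    simp only [Function.comp_apply, Function.update_self, hc, add_zero]
    congr 1
    refine Finset.sum_congr rfl fun i hi => ?_
    rw [Function.update_of_ne (Finset.ne_of_mem_erase hi)]
  generalize ∑ i, (outCount ∘ Function.update (L.team n h0 hn) j Z) i = x at h hupd
  have hx : x ≠ ⊤ := by
    rintro rfl
    simp at hupd
  have hcases : ∀ m : ℕ∞, (∀ i, i ≠ j → m ≤ (L.team n h0 hn i).demand) → m ≤ x := by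
    refine fun m hm => le_trans ((le_demand_parAll _).2 fun Q hQ => ?_) h
    obtain ⟨i, rfl⟩ := (List.mem_ofFn' _ _).1 hQ
    rcases eq_or_ne i j with rfl | hij
    · simp [hd]
    · simpa [hij] using hm i hij
  rcases eq_or_ne j 0 with rfl | hj
  · exact hx (top_le_iff.1 (hcases ⊤ fun i hi => by simp [hde, hi]))
  · have h1 := hcases n fun i _ => by rw [hde]; split_ifs <;> simp
    rw [hle, if_neg hj] at hupd
    lift x to ℕ using hx
    norm_cast at h1 hupd
    omega

theorem mustCoordinate (h0 : n ≠ 0) (hn : L.coord = .binary → n = 1) :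
    L.MustCoordinate (n + 1) :=
  ⟨L.team n h0 hn, (exists_red_team).imp fun _ h => h.1,
    not_reduces_update_team (by simp [demand]) (by simp [outCount])⟩

theorem add_one_le_cood (h0 : n ≠ 0) (hn : L.coord = .binary → n = 1) :
    ((n + 1 : ℕ) : ℕ∞) ≤ L.cood :=
  le_iSup₂ (f := fun (n : ℕ) (_ : L.MustCoordinate n) => (n : ℕ∞)) (n + 1) (mustCoordinate h0 hn)

theorem cood_eq_two (hL : L.coord = .binary) : L.cood = 2 :=
  (cood_le_two hL).antisymm (add_one_le_cood one_ne_zero fun _ => rfl)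

theorem cood_eq_top (hL : L.coord = .joining) : L.cood = ⊤ := by
  refine ENat.eq_top_iff_forall_ge.2 fun n => ?_
  refine le_trans ?_ (add_one_le_cood (L := L) n.succ_ne_zero (by simp [hL]))
  exact_mod_cast (by omega)

end Lang

/-! ## Encodings -/

theorem AlphaEq.fill {k : ℕ} {S S' : Fin k → Proc L} (h : ∀ i, AlphaEq (S i) (S' i))
    (C : Ctx L k) : AlphaEq (C.fill S) (C.fill S') := by
  induction C with
  | hole i => exact h i
  | op o args ih =>
    cases o with
    | nil => exact .refl _
    | ok => exact .refl _
    | outA h o => exact .refl _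
    | outS h o => exact .outS h o (ih (0 : Fin 1))
    | inp G => exact .inp G (ih (0 : Fin 1))
    | res a => exact .res a (ih (0 : Fin 1))
    | par => exact .par (ih (0 : Fin 2)) (ih (1 : Fin 2))
    | ite s t => exact .ite s t (ih (0 : Fin 2)) (ih (1 : Fin 2))
    | rep => exact .rep (ih (0 : Fin 1))

variable {L₁ L₂ : Lang} {eqv : Proc L₂ → Proc L₂ → Prop} {E : Encoding L₁ L₂}

/-- The translation of a parallel composition is a local function of the translated components, as
long as their free names are fixed. -/
theorem Encoding.Valid.exists_isLocal (hE : E.Valid eqv) {ι : Type*} [Nonempty ι] (N : Finset Name)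
    (l : List ι) : ∃ F : (ι → Proc L₂) → Proc L₂, IsLocal F ∧ ∀ S : ι → Proc L₁,
      (∀ i, (S i).fn = N) → AlphaEq (E.enc (parAll (l.map S))) (F fun i => E.enc (S i)) := by
  induction l with
  | nil => exact ⟨_, .const (E.enc nil), fun S _ => .refl _⟩
  | cons i l ih =>
    obtain ⟨F, hF, hS⟩ := ih
    obtain ⟨C, -, hC⟩ := hE.compositional .par N
    have hG : ∀ j : Fin 2, IsLocal ((![fun S => S i, F] : Fin 2 → (ι → Proc L₂) → Proc L₂) j) := by
      intro j
      match j with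
      | 0 => exact .proj i
      | 1 => exact hF
    refine ⟨_, .fill (k := 2) C hG, fun S hN => ?_⟩
    -- The tail may be `nil`, without free names; inclusion in `N` suffices, since its union with
    -- the free names of `S i` is then exactly `N`.
    have hsub : ∀ l : List ι, (parAll (l.map S)).fn ⊆ N := fun l => by
      induction l with
      | nil => exact Finset.empty_subset _
      | cons i l ih => exact Finset.union_subset (hN i).subset ih
    refine (hC ![S i, parAll (l.map S)] ?_).trans (AlphaEq.fill (fun j : Fin 2 => ?_) C)
    · have : ∀ T : Fin 2 → Proc L₁, (Finset.univ.biUnion fun i => (T i).fn) =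
          (T 0).fn ∪ (T 1).fn := fun T => by ext; simp [Fin.exists_fin_two]
      refine (this _).trans ?_
      simpa [hN i] using hsub l
    · match j with
      | 0 => exact .refl _
      | 1 => exact hS S hN

/-- A process reduces if its translation does: otherwise the translation would diverge. -/
theorem Encoding.Valid.reduces_of_reduces_enc (hE : E.Valid eqv) (hred : ReductionSensitive eqv)
    {S : Proc L₁} (h : (E.enc S).Reduces) : S.Reduces := by
  by_contra hS
  have hS' : ∀ S', Reds S S' → S' = S := fun S' h' => by
    rcases Relation.ReflTransGen.cases_head h' with rfl | ⟨Q, hQ, -⟩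
    · rfl
    · exact (hS ⟨Q, hQ⟩).elim
  -- Every derivative `T` evolves to something equivalent to `E.enc S`, because `S` has no other
  -- derivative. If that takes no step, `T` reduces by reduction sensitivity.
  have step : ∀ T : {T // Reds (E.enc S) T}, ∃ T' : {T // Reds (E.enc S) T}, Red T.1 T'.1 := by
    rintro ⟨T, hT⟩
    obtain ⟨S', T', h1, h2, h3⟩ := hE.sound S T hT
    rw [hS' S' h1] at h3
    have : T.Reduces := by
      rcases Relation.ReflTransGen.cases_head h2 with rfl | ⟨Q, hQ, -⟩
      · exact hred _ _ h3 h
      · exact ⟨Q, hQ⟩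
    obtain ⟨Q, hQ⟩ := this
    exact ⟨⟨Q, hT.tail hQ⟩, hQ⟩
  choose next hnext using step
  let f : ℕ → {T // Reds (E.enc S) T} := Nat.rec ⟨E.enc S, Relation.ReflTransGen.refl⟩ fun _ => next
  obtain ⟨f, hf, hf'⟩ := hE.divergence_reflecting S ⟨fun n => (f n).1, rfl, fun n => hnext (f n)⟩
  exact hS ⟨f 1, hf ▸ hf' 0⟩

end Coordination

/-! ### The separation theorem -/

open Coordination Proc in
theorem mainTheorem1 (L₁ L₂ : Coordination.Lang) (h : L₁.cood > L₂.cood)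
    (eqv : Coordination.Proc L₂ → Coordination.Proc L₂ → Prop) (heqv : Equivalence eqv)
    (hred : Coordination.ReductionSensitive eqv) :
    ¬ ∃ E : Coordination.Encoding L₁ L₂, E.Valid eqv := by
  rintro ⟨E, hE⟩
  have h₂ : L₂.coord = .binary := by
    cases hc : L₂.coord with
    | binary => rfl
    | joining => simp [Lang.cood_eq_top hc] at h
  have h₁ : L₁.coord = .binary → 2 = 1 := fun hc => by
    simp [Lang.cood_eq_two hc, Lang.cood_eq_two h₂] at h
  -- Two senders and a receiver: three components, one more than a communication in `L₂` can
  -- involve.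
  set S := L₁.team 2 two_ne_zero h₁
  obtain ⟨F, hF, hFS⟩ := hE.exists_isLocal {0} (List.finRange 3)
  simp only [← List.ofFn_eq_map] at hFS
  have succ : (parAll (List.ofFn S)).Succeeds := by
    obtain ⟨P, hP, hok⟩ := Lang.exists_red_team (L := L₁) (h0 := two_ne_zero) (hn := h₁)
    obtain ⟨P', hP'⟩ := hok.exists_structEq
    exact ⟨P, P', .single hP, hP'⟩
  have key : ∃ i j, ∀ S' : Fin 3 → Proc L₂, S' i = E.enc (S i) → S' j = E.enc (S j) →
      (F S').HasOk ∨ (F S').Communicates := by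
    have e := StructEq.alpha (hFS S fun i => Lang.team_fn i)
    rcases ((hE.success_sensitive _).1 succ).hasOk_or_reduces with h | h
    · obtain ⟨i, hi⟩ := hF.hasOk _ (e.counts_eq.2.2.1 h)
      exact ⟨i, i, fun S' h _ => Or.inl (hi S' h)⟩
    · obtain ⟨i, j, hij⟩ := hF.communicates _
        (e.communicates_iff.1 ((reduces_iff_communicates h₂).1 h))
      exact ⟨i, j, fun S' h h' => Or.inr (hij S' h h')⟩
  obtain ⟨i, j, hij⟩ := key
  obtain ⟨l, hi, hj⟩ := exists_ne_and_ne (by norm_num) i j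
  -- Unlike `nil`, this inert process has the free names `{0}`, so the same `F` describes the
  -- translation after the replacement.
  set Z : Proc L₁ := .ite (.name 0) (.name 0) .nil .nil
  have hZr : ¬ (parAll (List.ofFn (Function.update S l Z))).Reduces :=
    Lang.not_reduces_update_team (by simp [Z, demand]) (by simp [Z, outCount]) l
  have hZs : ¬ (parAll (List.ofFn (Function.update S l Z))).Succeeds := fun hs => by
    refine hs.hasOk_or_reduces.elim (fun hok => ?_) hZr
    obtain ⟨P, hP, hok⟩ := (hasOk_parAll _).1 hok
    obtain ⟨m, rfl⟩ := (List.mem_ofFn' _ _).1 hP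
    rcases eq_or_ne m l with rfl | hm
    · simp [Z, HasOk] at hok
    · rw [Function.update_of_ne hm] at hok
      exact Lang.team_not_hasOk m hok
  have e := StructEq.alpha (hFS (Function.update S l Z) fun m => by
    rcases eq_or_ne m l with rfl | hm
    · simp [Z, fn, Term.names]
    · rw [Function.update_of_ne hm]
      exact Lang.team_fn m)
  rcases hij (fun m => E.enc (Function.update S l Z m)) (by simp [hi.symm]) (by simp [hj.symm])
    with h | h
  · exact hZs ((hE.success_sensitive _).2 (e.counts_eq.2.2.2 h).succeeds)
  · exact hZr (hE.reduces_of_reduces_enc hred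
      (((reduces_iff_communicates h₂).2 h).structEq e))
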